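/- Let $E$ be a real Banach lattice. Assume that $E$ is $2$-disjointly homogeneous: every sequence $(x_n)$ of pairwise disjoint elements of $E$ with $\|x_n\|=1$ has a subsequence $(x_{n_k})$ for which there is a constant $C>0$ with $$C^{-1}\Big(\sum_k |a_k|^2\Big)^{1/2}\le\Big\|\sum_k a_k x_{n_k}\Big\|\le C\Big(\sum_k |a_k|^2\Big)^{1/2}$$ for all finitely supported real sequences $(a_k)$. Assume also that $E$ has property $(C)$: the norm of $E$ is order continuous (every net decreasing to $0$ converges to $0$ in norm), and there exist $1\le q<\infty$ and a probability space $(\Omega,\Sigma,\mu)$ such that $L_q(\mu)\hookrightarrow E\hookrightarrow L_1(\mu)$, that is, $E$ is identified, by a continuous injective lattice homomorphism, with a sublattice of $L_1(\mu)$ containing $L_q(\mu)$. Then $\mathcal S(E)=\mathcal K(E)$: a bounded linear operator $T:E\to E$ is strictly singular (its restriction to any infinite-dimensional subspace is not an isomorphism onto its image) if and only if it is compact. -/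

import Mathlib

open MeasureTheory
open scoped ENNReal

universe u v

/-- The norm of a Banach lattice is order continuous: every downward directed set with infimum `0`
contains elements of arbitrarily small norm. Since the norm is monotone on the positive cone, this
says that every net decreasing to `0` converges to `0` in norm. -/
def IsOrderContinuousNorm (E : Type*) [NormedAddCommGroup E] [Lattice E] : Prop :=
  ∀ s : Set E, s.Nonempty → DirectedOn (fun x y => y ≤ x) s → IsGLB s (0 : E) →
    ∀ ε : ℝ, 0 < ε → ∃ x ∈ s, ‖x‖ < ε

/-- A sequence of pairwise disjoint elements of norm one. -/
def IsNormalizedDisjoint {E : Type*} [NormedAddCommGroup E] [Lattice E] (x : ℕ → E) : Prop :=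
  (∀ n, ‖x n‖ = 1) ∧ ∀ m n, m ≠ n → |x m| ⊓ |x n| = 0

/-- `x` is equivalent to the unit vector basis of `ℓ_p`, for finite `p`. -/
def IsEquivalentToLpBasis {E : Type*} [NormedAddCommGroup E] [NormedSpace ℝ E] (p : ℝ)
    (x : ℕ → E) : Prop :=
  ∃ C : ℝ, 0 < C ∧ ∀ (N : ℕ) (a : ℕ → ℝ),
    C⁻¹ * (∑ k ∈ Finset.range N, |a k| ^ p) ^ (1 / p) ≤ ‖∑ k ∈ Finset.range N, a k • x k‖ ∧
    ‖∑ k ∈ Finset.range N, a k • x k‖ ≤ C * (∑ k ∈ Finset.range N, |a k| ^ p) ^ (1 / p)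

/-- `p`-disjointly homogeneous, for `1 ≤ p < ∞`: every normalized disjoint sequence has a
subsequence equivalent to the unit vector basis of `ℓ_p`. -/
def IsDisjointlyHomogeneous (p : ℝ) (E : Type*) [NormedAddCommGroup E] [Lattice E]
    [NormedSpace ℝ E] : Prop :=
  ∀ x : ℕ → E, IsNormalizedDisjoint x →
    ∃ φ : ℕ → ℕ, StrictMono φ ∧ IsEquivalentToLpBasis p (x ∘ φ)

/-- Property (C): `E` is order continuous and, for some `1 ≤ q < ∞` and some probability space,
`L_q(μ) ⊂ E ⊂ L_1(μ)`. The inclusion of `E` is a continuous injective lattice homomorphism `J` into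
`L_1(μ)`, and its range contains (the class of) every function of `L_q(μ)`. -/
def HasPropertyC (E : Type u) [NormedAddCommGroup E] [Lattice E] [NormedSpace ℝ E] : Prop :=
  IsOrderContinuousNorm E ∧
    ∃ (q : ℝ≥0∞) (Ω : Type v) (_ : MeasurableSpace Ω) (μ : Measure Ω) (J : E →L[ℝ] Lp ℝ 1 μ),
      1 ≤ q ∧ q ≠ ∞ ∧ IsProbabilityMeasure μ ∧
      Function.Injective J ∧
      (∀ x y : E, J (x ⊔ y) = J x ⊔ J y) ∧ (∀ x y : E, J (x ⊓ y) = J x ⊓ J y) ∧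
      ∀ f : Lp ℝ q μ, ∃ x : E, (J x : Ω → ℝ) =ᵐ[μ] (f : Ω → ℝ)

/-- `T` is strictly singular: its restriction to an infinite-dimensional subspace is never an
isomorphism onto its image, that is, never bounded below. -/
def IsStrictlySingular {X Y : Type*} [NormedAddCommGroup X] [NormedSpace ℝ X]
    [NormedAddCommGroup Y] [NormedSpace ℝ Y] (T : X →L[ℝ] Y) : Prop :=
  ∀ M : Submodule ℝ X, ¬ FiniteDimensional ℝ M → ¬ ∃ c : ℝ, 0 < c ∧ ∀ x ∈ M, c * ‖x‖ ≤ ‖T x‖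

/-- The set of strictly singular endomorphisms of `X`. -/
def strictlySingularOperators (X : Type*) [NormedAddCommGroup X] [NormedSpace ℝ X] :
    Set (X →L[ℝ] X) :=
  {T | IsStrictlySingular T}

/-- The set of compact endomorphisms of `X`. -/
def compactOperators (X : Type*) [NormedAddCommGroup X] [NormedSpace ℝ X] : Set (X →L[ℝ] X) :=
  {T | IsCompactOperator T}

/-! A compact operator is bounded below on no infinite-dimensional subspace, by Riesz's lemma. The
substance is the converse, and it rests on one principle,
`IsLatticeEmbeddingAbove.not_isStrictlySingular`: if `x` is dominated by the `ℓ₂` basis and `T (x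
n)` stays away from `0`, then `T` is not strictly singular. It suffices that a subsequence of `T (x
n)` dominates the `ℓ₂` basis, for then `T` is bounded below on the span of the corresponding `x n`.

Such a subsequence comes from a Kadec–Pełczyński dichotomy for `y n = T (x n)`, which is weakly
null. If `y n` does not approach `0` in measure, a Riesz product with imaginary coefficients gives a
lower `ℓ₂` estimate already in `L₁` (`exists_subseq_le_integral_abs_sum`), hence in `E`. Otherwise a
subsequence is close to a disjoint sequence (`exists_subseq_near_disjoint`), and disjoint
homogeneity gives the estimate.

For `T` strictly singular the principle is used twice. Disjoint homogeneity supplies upper `ℓ₂`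
estimates for normalized disjoint sequences, so `T` sends bounded disjoint sequences to null ones;
together with order continuity this reduces the unit ball, up to small errors, to elements bounded
as functions. On these, if the image were not totally bounded, differences of a separated sequence
could be chosen almost multiplicatively independent; a real Riesz product bounds all their moments
by the `ℓ₂` norm of the coefficients, and `L_q ⊂ E` turns this into an upper `ℓ₂` estimate in `E`, a
contradiction. -/

/-- A sequence can be built one term at a time, when each partial sequence satisfying the
requirement `Q` so far has an admissible next term. -/
theorem exists_seq_of_forall_step {ι : Type*} [Nonempty ι] (Q : ℕ → (ℕ → ι) → ι → Prop)
    (hcongr : ∀ k f g i, (∀ j < k, f j = g j) → Q k f i → Q k g i)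
    (step : ∀ k f, (∀ j < k, Q j f (f j)) → ∃ i, Q k f i) :
    ∃ f : ℕ → ι, ∀ k, Q k f (f k) := by
  classical
  let c : ℕ → (ℕ → ι) → ι := fun k f =>
    if h : ∃ i, Q k f i then h.choose else Classical.arbitrary ι
  -- The entries of `F k` from position `k` on are arbitrary; `hcongr` says that `Q k` ignores them.
  let F : ℕ → ℕ → ι := fun k => Nat.rec (fun _ => Classical.arbitrary ι)
    (fun k f => Function.update f k (c k f)) k
  have hF : ∀ k, F (k + 1) = Function.update (F k) k (c k (F k)) := fun k => rfl
  have hagree : ∀ k j, j < k → F k j = F (j + 1) j := by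
    intro k
    induction k with
    | zero => intro j hj; omega
    | succ k ih =>
      intro j hj
      rcases Nat.lt_succ_iff_lt_or_eq.mp hj with h | rfl
      · rw [hF, Function.update_of_ne h.ne, ih j h]
      · rfl
  refine ⟨fun k => F (k + 1) k, fun k => ?_⟩
  induction k using Nat.strong_induction_on with
  | _ k ih =>
    obtain ⟨i, hi⟩ := step k _ ih
    have h : ∃ i, Q k (F k) i := ⟨i, hcongr k _ _ i (fun j hj => (hagree k j hj).symm) hi⟩
    have hc : Q k (F k) (c k (F k)) := by
      simp only [c, dif_pos h]
      exact h.choose_spec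
    have he : F (k + 1) k = c k (F k) := by rw [hF, Function.update_self]
    simp only [he]
    exact hcongr k _ _ _ (fun j hj => hagree k j hj) hc

theorem smul_inf_eq_zero {E : Type*} [AddCommGroup E] [Lattice E] [IsOrderedAddMonoid E]
    [Module ℝ E] [IsOrderedModule ℝ E] {x y : E} {c : ℝ} (hc : 0 ≤ c) (hx : 0 ≤ x) (hy : 0 ≤ y)
    (h : x ⊓ y = 0) : (c • x) ⊓ y = 0 := by
  rcases hc.eq_or_lt with rfl | hc
  · simpa using hy
  -- The factor `max c 1` dominates the coefficients of both `c • x` and `y`, so dividing by it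
  -- lands below `x ⊓ y`.
  have hm : (0 : ℝ) < max c 1 := lt_max_of_lt_left hc
  refine le_antisymm ?_ (le_inf (smul_nonneg hc.le hx) hy)
  have h1 : (c • x) ⊓ y ≤ max c 1 • x :=
    inf_le_left.trans (smul_le_smul_of_nonneg_right (le_max_left _ _) hx)
  have h2 : (c • x) ⊓ y ≤ max c 1 • y := by
    refine inf_le_right.trans ?_
    simpa using smul_le_smul_of_nonneg_right (le_max_right c 1) hy
  have h3 : (max c 1)⁻¹ • ((c • x) ⊓ y) ≤ x ⊓ y := by
    refine le_inf ?_ ?_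
    · simpa [smul_smul, inv_mul_cancel₀ hm.ne'] using
        smul_le_smul_of_nonneg_left h1 (inv_pos.mpr hm).le
    · simpa [smul_smul, inv_mul_cancel₀ hm.ne'] using
        smul_le_smul_of_nonneg_left h2 (inv_pos.mpr hm).le
  rw [h] at h3
  simpa [smul_smul, mul_inv_cancel₀ hm.ne'] using smul_le_smul_of_nonneg_left h3 hm.le

/-! ### Disjointification in Banach lattices -/

section Lattice

variable {E : Type*} [NormedAddCommGroup E] [Lattice E] [IsOrderedAddMonoid E] [HasSolidNorm E]

theorem norm_le_norm_of_nonneg_of_le {x y : E} (hx : 0 ≤ x) (hxy : x ≤ y) : ‖x‖ ≤ ‖y‖ :=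
  norm_le_norm_of_abs_le_abs (by rwa [abs_of_nonneg hx, abs_of_nonneg (hx.trans hxy)])

theorem norm_posPart_le (x : E) : ‖x⁺‖ ≤ ‖x‖ :=
  norm_le_norm_of_abs_le_abs (by
    rw [abs_of_nonneg (posPart_nonneg x)]; exact sup_le (le_abs_self x) (abs_nonneg x))

theorem norm_negPart_le (x : E) : ‖x⁻‖ ≤ ‖x‖ := by
  have := norm_posPart_le (-x)
  rwa [norm_neg, posPart_neg] at this

variable [NormedSpace ℝ E] [IsOrderedModule ℝ E]

/-- The part of `x n` exceeding a large multiple of the previous terms is close to the `n`-th term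
of a disjoint sequence. -/
theorem exists_disjoint_near_posPart [CompleteSpace E] (x : ℕ → E) (hx : ∀ n, 0 ≤ x n)
    (hx1 : ∀ n, ‖x n‖ ≤ 1) :
    ∃ v : ℕ → E, (∀ n, 0 ≤ v n) ∧
      (∀ n, v n ≤ (x n - (4 : ℝ) ^ n • ∑ i ∈ Finset.range n, x i)⁺) ∧
      (∀ n, ‖(x n - (4 : ℝ) ^ n • ∑ i ∈ Finset.range n, x i)⁺ - v n‖ ≤ 2 * (1 / 2) ^ n) ∧
      ∀ m n, m ≠ n → v m ⊓ v n = 0 := by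
  have hbd : ∀ i, ‖((1 / 2 : ℝ) ^ i) • x i‖ ≤ (1 / 2 : ℝ) ^ i := fun i => by
    rw [norm_smul, norm_pow, Real.norm_of_nonneg (by norm_num : (0 : ℝ) ≤ 1 / 2)]
    exact mul_le_of_le_one_right (by positivity) (hx1 i)
  have hsum : Summable fun i => ((1 / 2 : ℝ) ^ i) • x i :=
    Summable.of_norm_bounded summable_geometric_two hbd
  -- One element dominating every `2⁻ⁱ x i`; subtracting `2⁻ⁿ y` from the `n`-th excess costs little
  -- norm and makes the remainders exactly disjoint.
  set y : E := ∑' i, ((1 / 2 : ℝ) ^ i) • x i with hy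
  have hyn : ‖y‖ ≤ 2 := by
    have := tsum_of_norm_bounded hasSum_geometric_two hbd
    exact this
  have hterm : ∀ i, 0 ≤ ((1 / 2 : ℝ) ^ i) • x i := fun i => smul_nonneg (by positivity) (hx i)
  have hxy : ∀ i, ((1 / 2 : ℝ) ^ i) • x i ≤ y := fun i =>
    hsum.le_tsum i fun j _ => hterm j
  have hy0 : 0 ≤ y := (hterm 0).trans (hxy 0)
  set p : ℕ → E := fun n => x n - (4 : ℝ) ^ n • ∑ i ∈ Finset.range n, x i with hp
  have hS : ∀ n, 0 ≤ (4 : ℝ) ^ n • ∑ i ∈ Finset.range n, x i := fun n =>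
    smul_nonneg (by positivity) (Finset.sum_nonneg fun i _ => hx i)
  have hyk : ∀ n, 0 ≤ ((1 / 2 : ℝ) ^ n) • y := fun n => smul_nonneg (by positivity) hy0
  set v : ℕ → E := fun n => (p n - ((1 / 2 : ℝ) ^ n) • y)⁺ with hv
  have hvp : ∀ n, v n ≤ (p n)⁺ := fun n => posPart_mono (sub_le_self _ (hyk n))
  refine ⟨v, fun n => posPart_nonneg _, hvp, fun n => ?_, ?_⟩
  · have h1 : (p n)⁺ - v n ≤ ((1 / 2 : ℝ) ^ n) • y := by
      rw [sub_le_iff_le_add]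
      refine sup_le ?_ (add_nonneg (hyk n) (posPart_nonneg _))
      rw [← sub_le_iff_le_add']
      exact le_posPart _
    calc ‖(p n)⁺ - v n‖ ≤ ‖((1 / 2 : ℝ) ^ n) • y‖ :=
          norm_le_norm_of_nonneg_of_le (sub_nonneg.mpr (hvp n)) h1
      _ ≤ 2 * (1 / 2) ^ n := by
          rw [norm_smul, norm_pow, Real.norm_of_nonneg (by norm_num : (0 : ℝ) ≤ 1 / 2), mul_comm]
          gcongr
  -- For `m < n` both remainders are compared with `z = 4ⁿ x m - x n`: the earlier one lies below
  -- `z⁺`, because `4⁻ⁿ x n ≤ 2⁻ⁿ y ≤ 2⁻ᵐ y`, and the later one below `z⁻`.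
  · have key : ∀ m n, m < n → v m ⊓ v n = 0 := by
      intro m n hmn
      set z : E := (4 : ℝ) ^ n • x m - x n with hz
      have h1 : v m ≤ z⁺ := by
        refine sup_le ?_ (posPart_nonneg _)
        have h4 : ((1 / 4 : ℝ) ^ n) • z ≤ z⁺ := by
          calc ((1 / 4 : ℝ) ^ n) • z ≤ ((1 / 4 : ℝ) ^ n) • z⁺ :=
                smul_le_smul_of_nonneg_left (le_posPart z) (by positivity)
            _ ≤ (1 : ℝ) • z⁺ := smul_le_smul_of_nonneg_right
                (pow_le_one₀ (by norm_num) (by norm_num)) (posPart_nonneg z)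
            _ = z⁺ := one_smul _ _
        refine le_trans ?_ h4
        have h5 : ((1 / 4 : ℝ) ^ n) • z = x m - ((1 / 4 : ℝ) ^ n) • x n := by
          rw [hz, smul_sub, smul_smul, ← mul_pow]
          norm_num
        rw [h5]
        refine sub_le_sub (sub_le_self _ (hS m)) ?_
        calc ((1 / 4 : ℝ) ^ n) • x n = ((1 / 2 : ℝ) ^ n) • ((1 / 2 : ℝ) ^ n) • x n := by
              rw [smul_smul, ← mul_pow]; norm_num
          _ ≤ ((1 / 2 : ℝ) ^ n) • y := smul_le_smul_of_nonneg_left (hxy n) (by positivity)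
          _ ≤ ((1 / 2 : ℝ) ^ m) • y := smul_le_smul_of_nonneg_right
              (pow_le_pow_of_le_one (by norm_num) (by norm_num) hmn.le) hy0
      have h2 : v n ≤ z⁻ := by
        have h6 : x m ≤ ∑ i ∈ Finset.range n, x i :=
          Finset.single_le_sum (f := x) (fun i _ => hx i) (Finset.mem_range.mpr hmn)
        have h7 : (4 : ℝ) ^ n • x m ≤ (4 : ℝ) ^ n • ∑ i ∈ Finset.range n, x i :=
          smul_le_smul_of_nonneg_left h6 (by positivity)
        refine posPart_mono (((sub_le_self _ (hyk n)).trans ?_) : _ ≤ -z)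
        rw [hz, neg_sub]
        exact sub_le_sub_left h7 _
      refine le_antisymm ?_ (le_inf (posPart_nonneg _) (posPart_nonneg _))
      rw [← posPart_inf_negPart_eq_zero z]
      exact inf_le_inf h1 h2
    intro m n hmn
    rcases lt_or_gt_of_ne hmn with h | h
    · exact key m n h
    · rw [inf_comm]; exact key n m h

/-- An operator sending bounded positive disjoint sequences to null sequences is small, uniformly on
the positive part of the unit ball, on the excess over a suitable element. -/
theorem exists_forall_norm_map_posPart_sub_le [CompleteSpace E] {Y : Type*} [NormedAddCommGroup Y]
    [NormedSpace ℝ Y] (T : E →L[ℝ] Y)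
    (hT : ∀ h : ℕ → E, (∀ n, 0 ≤ h n) → (∀ n, ‖h n‖ ≤ 1) → (∀ m n, m ≠ n → h m ⊓ h n = 0) →
      ∀ ε : ℝ, 0 < ε → ∃ N, ∀ n ≥ N, ‖T (h n)‖ < ε) {ε : ℝ} (hε : 0 < ε) :
    ∃ u : E, 0 ≤ u ∧ ∀ x : E, 0 ≤ x → ‖x‖ ≤ 1 → ‖T (x - u)⁺‖ ≤ ε := by
  by_contra! hcon
  -- The failing bound at step `k` is taken to be `4ᵏ` times the sum of the earlier terms, as the
  -- disjointification requires.
  obtain ⟨x, hx⟩ := exists_seq_of_forall_step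
    (Q := fun k (f : ℕ → E) (i : E) => 0 ≤ i ∧ ‖i‖ ≤ 1 ∧
      ε < ‖T (i - (4 : ℝ) ^ k • ∑ j ∈ Finset.range k, f j)⁺‖)
    (by
      intro k f g i hfg hi
      rwa [Finset.sum_congr rfl fun j hj => (hfg j (Finset.mem_range.mp hj)).symm])
    (by
      intro k f hf
      obtain ⟨i, h1, h2, h3⟩ := hcon ((4 : ℝ) ^ k • ∑ j ∈ Finset.range k, f j)
        (smul_nonneg (by positivity)
          (Finset.sum_nonneg fun j hj => (hf j (Finset.mem_range.mp hj)).1))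
      exact ⟨i, h1, h2, h3⟩)
  obtain ⟨v, hv0, hvw, hvn, hvd⟩ :=
    exists_disjoint_near_posPart x (fun n => (hx n).1) (fun n => (hx n).2.1)
  have hv1 : ∀ n, ‖v n‖ ≤ 1 := fun n => by
    refine (norm_le_norm_of_nonneg_of_le (hv0 n) ((hvw n).trans (posPart_mono (sub_le_self _ ?_)))
      |>.trans (norm_posPart_le _)).trans (hx n).2.1
    exact smul_nonneg (by positivity) (Finset.sum_nonneg fun j _ => (hx j).1)
  obtain ⟨N, hN⟩ := hT v hv0 hv1 hvd (ε / 2) (by positivity)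
  have hlim : Filter.Tendsto (fun n : ℕ => ‖T‖ * (2 * (1 / 2 : ℝ) ^ n)) Filter.atTop (nhds 0) := by
    have := (tendsto_pow_atTop_nhds_zero_of_lt_one (by norm_num : (0 : ℝ) ≤ 1 / 2)
      (by norm_num)).const_mul (‖T‖ * 2)
    simpa [mul_assoc] using this
  obtain ⟨n, hn, hnN⟩ := ((hlim.eventually (gt_mem_nhds (half_pos hε))).and
    (Filter.eventually_ge_atTop N)).exists
  have h1 := (hx n).2.2
  set w := (x n - (4 : ℝ) ^ n • ∑ j ∈ Finset.range n, x j)⁺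
  have h2 : ‖T w‖ ≤ ‖T (w - v n)‖ + ‖T (v n)‖ := by
    have := norm_add_le (T (w - v n)) (T (v n))
    rwa [← map_add, sub_add_cancel] at this
  have h3 : ‖T (w - v n)‖ ≤ ‖T‖ * (2 * (1 / 2 : ℝ) ^ n) :=
    (T.le_opNorm _).trans (mul_le_mul_of_nonneg_left (hvn n) (norm_nonneg _))
  linarith [hN n hnN]

/-- **Kadec–Pełczyński disjointification**: a bounded sequence whose meets with each positive
element are small infinitely often has a subsequence close to a disjoint sequence. -/
theorem exists_subseq_near_disjoint [CompleteSpace E] (y : ℕ → E) (hy : ∀ n, ‖y n‖ ≤ 1)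
    (h : ∀ u : E, 0 ≤ u → ∀ ε : ℝ, 0 < ε → ∀ N, ∃ n ≥ N, ‖|y n| ⊓ u‖ < ε) :
    ∃ (φ : ℕ → ℕ) (d : ℕ → E), StrictMono φ ∧ (∀ m n, m ≠ n → |d m| ⊓ |d n| = 0) ∧
      ∀ k, ‖y (φ k) - d k‖ ≤ 6 * (1 / 2) ^ k := by
  obtain ⟨φ, hφ⟩ := exists_seq_of_forall_step
    (Q := fun k (f : ℕ → ℕ) (i : ℕ) => (∀ j < k, f j < i) ∧
      ‖|y i| ⊓ ((4 : ℝ) ^ k • ∑ j ∈ Finset.range k, |y (f j)|)‖ < (1 / 2) ^ k)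
    (by
      intro k f g i hfg hi
      rw [Finset.sum_congr rfl fun j hj => by rw [hfg j (Finset.mem_range.mp hj)]] at hi
      exact ⟨fun j hj => hfg j hj ▸ hi.1 j hj, hi.2⟩)
    (by
      intro k f _
      obtain ⟨n, hn, h2⟩ := h ((4 : ℝ) ^ k • ∑ j ∈ Finset.range k, |y (f j)|)
        (smul_nonneg (by positivity) (Finset.sum_nonneg fun j _ => abs_nonneg _))
        ((1 / 2) ^ k) (by positivity) (∑ j ∈ Finset.range k, f j + 1)
      refine ⟨n, fun j hj => ?_, h2⟩
      have := Finset.single_le_sum (f := f) (fun i _ => Nat.zero_le _) (Finset.mem_range.mpr hj)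
      omega)
  obtain ⟨v, hv0, hvw, hvn, hvd⟩ := exists_disjoint_near_posPart (fun k => |y (φ k)|)
    (fun n => abs_nonneg _) (fun n => by rw [norm_abs_eq_norm]; exact hy _)
  -- Cutting the positive and negative parts separately restores the sign while keeping `|d k|`
  -- below a multiple of `v k`.
  set d : ℕ → E := fun k => (y (φ k))⁺ ⊓ v k - (y (φ k))⁻ ⊓ v k with hd
  have hdv : ∀ k, |d k| ≤ (2 : ℝ) • v k := fun k => by
    rw [two_smul]
    have h1 : 0 ≤ (y (φ k))⁺ ⊓ v k := le_inf (posPart_nonneg _) (hv0 k)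
    have h2 : 0 ≤ (y (φ k))⁻ ⊓ v k := le_inf (negPart_nonneg _) (hv0 k)
    refine abs_le'.mpr ⟨?_, ?_⟩
    · exact ((sub_le_self _ h2).trans inf_le_right).trans (le_add_of_nonneg_right (hv0 k))
    · rw [hd, neg_sub]
      exact ((sub_le_self _ h1).trans inf_le_right).trans (le_add_of_nonneg_right (hv0 k))
  refine ⟨φ, d, fun m n hmn => (hφ n).1 m hmn, fun m n hmn => ?_, fun k => ?_⟩
  · refine le_antisymm ?_ (le_inf (abs_nonneg _) (abs_nonneg _))
    refine (inf_le_inf (hdv m) (hdv n)).trans (le_of_eq ?_)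
    have h1 := smul_inf_eq_zero (c := 2) (by norm_num) (hv0 m) (hv0 n) (hvd m n hmn)
    rw [inf_comm] at h1
    have h2 := smul_inf_eq_zero (c := 2) (by norm_num) (hv0 n)
      (smul_nonneg (by norm_num : (0 : ℝ) ≤ 2) (hv0 m)) h1
    rwa [inf_comm] at h2
  · set w := |y (φ k)| with hw
    set S := (4 : ℝ) ^ k • ∑ j ∈ Finset.range k, |y (φ j)| with hS
    have hS0 : 0 ≤ S := smul_nonneg (by positivity) (Finset.sum_nonneg fun j _ => abs_nonneg _)
    have hvk : v k ≤ w :=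
      (hvw k).trans ((posPart_mono (sub_le_self _ hS0)).trans (posPart_eq_self.mpr (abs_nonneg _)).le)
    have hwv : ‖w - v k‖ ≤ 3 * (1 / 2) ^ k := by
      have h1 : w - v k = (w ⊓ S) + ((w - S)⁺ - v k) := by
        rw [inf_eq_sub_posPart_sub]; abel
      rw [h1]
      refine (norm_add_le _ _).trans ?_
      have := hvn k
      have h3 := (hφ k).2
      linarith [h3.le]
    have hpart : ∀ a : E, 0 ≤ a → a ≤ w → ‖a - a ⊓ v k‖ ≤ 3 * (1 / 2) ^ k := by
      intro a ha haw
      refine le_trans (norm_le_norm_of_nonneg_of_le (sub_nonneg.mpr inf_le_left) ?_) hwv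
      rw [inf_eq_sub_posPart_sub, sub_sub_cancel]
      exact sup_le (sub_le_sub_right haw _) (sub_nonneg.mpr hvk)
    have h1 := hpart (y (φ k))⁺ (posPart_nonneg _) (sup_le (le_abs_self _) (abs_nonneg _))
    have h2 := hpart (y (φ k))⁻ (negPart_nonneg _) (sup_le (neg_le_abs _) (abs_nonneg _))
    have h3 : y (φ k) - d k = ((y (φ k))⁺ - (y (φ k))⁺ ⊓ v k) -
        ((y (φ k))⁻ - (y (φ k))⁻ ⊓ v k) := by
      conv_lhs => rw [← posPart_sub_negPart (y (φ k))]
      rw [hd]; simp only []; abel_nf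
    rw [h3]
    refine (norm_sub_le _ _).trans ?_
    linarith

end Lattice

/-! ### Working with elements of the lattice as functions -/

/-- A continuous lattice embedding into `L₁` whose range contains `L_q`. -/
structure IsLatticeEmbeddingAbove {E : Type*} [NormedAddCommGroup E] [Lattice E] [NormedSpace ℝ E]
    {Ω : Type*} [MeasurableSpace Ω] {μ : Measure Ω} (q : ℝ≥0∞) (J : E →L[ℝ] Lp ℝ 1 μ) : Prop where
  injective : Function.Injective J
  map_sup : ∀ x y : E, J (x ⊔ y) = J x ⊔ J y
  map_inf : ∀ x y : E, J (x ⊓ y) = J x ⊓ J y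
  exists_eq : ∀ f : Lp ℝ q μ, ∃ x : E, (J x : Ω → ℝ) =ᵐ[μ] (f : Ω → ℝ)

namespace IsLatticeEmbeddingAbove

variable {E : Type*} [NormedAddCommGroup E] [NormedSpace ℝ E] {Ω : Type*} [MeasurableSpace Ω]
  {μ : Measure Ω} {q : ℝ≥0∞}

theorem coeFn_smul (J : E →L[ℝ] Lp ℝ 1 μ) (c : ℝ) (x : E) :
    J (c • x) =ᵐ[μ] fun ω => c * J x ω := by
  rw [map_smul]
  exact Lp.coeFn_smul _ _

theorem coeFn_sub (J : E →L[ℝ] Lp ℝ 1 μ) (x y : E) :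
    J (x - y) =ᵐ[μ] fun ω => J x ω - J y ω := by
  rw [map_sub]
  exact Lp.coeFn_sub _ _

theorem coeFn_sum_smul (J : E →L[ℝ] Lp ℝ 1 μ) (s : Finset ℕ) (a : ℕ → ℝ) (x : ℕ → E) :
    J (∑ k ∈ s, a k • x k) =ᵐ[μ] fun ω => ∑ k ∈ s, a k * J (x k) ω := by
  classical
  induction s using Finset.induction_on with
  | empty =>
    simp only [Finset.sum_empty, map_zero]
    exact Lp.coeFn_zero _ _ _
  | insert k s hk ih =>
    simp only [Finset.sum_insert hk, map_add]
    have h1 := Lp.coeFn_add (J (a k • x k)) (J (∑ i ∈ s, a i • x i))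
    filter_upwards [h1, ih, coeFn_smul J (a k) (x k)] with ω h1 h2 h3
    rw [h1, Pi.add_apply, h2, h3]

variable [Lattice E] {J : E →L[ℝ] Lp ℝ 1 μ}

theorem coeFn_inf (hJ : IsLatticeEmbeddingAbove q J) (x y : E) :
    J (x ⊓ y) =ᵐ[μ] fun ω => min (J x ω) (J y ω) := by
  rw [hJ.map_inf]
  exact Lp.coeFn_inf _ _

theorem coeFn_sup (hJ : IsLatticeEmbeddingAbove q J) (x y : E) :
    J (x ⊔ y) =ᵐ[μ] fun ω => max (J x ω) (J y ω) := by
  rw [hJ.map_sup]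
  exact Lp.coeFn_sup _ _

theorem coeFn_abs (hJ : IsLatticeEmbeddingAbove q J) (x : E) :
    J |x| =ᵐ[μ] fun ω => |J x ω| := by
  have : J |x| = |J x| := by
    rw [abs, abs, hJ.map_sup, map_neg]
  rw [this]
  exact Lp.coeFn_abs _

theorem le_of_ae_le (hJ : IsLatticeEmbeddingAbove q J) {x y : E} (h : J x ≤ᵐ[μ] J y) :
    x ≤ y := by
  rw [← sup_eq_right]
  refine hJ.injective ?_
  rw [hJ.map_sup, sup_eq_right]
  exact (Lp.coeFn_le _ _).mp h

theorem ae_le_of_le (hJ : IsLatticeEmbeddingAbove q J) {x y : E} (h : x ≤ y) :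
    J x ≤ᵐ[μ] J y := by
  rw [Lp.coeFn_le, ← sup_eq_right, ← hJ.map_sup, sup_eq_right.mpr h]

theorem exists_coeFn_eq_one [IsProbabilityMeasure μ] (hJ : IsLatticeEmbeddingAbove q J) :
    ∃ e : E, 0 ≤ e ∧ J e =ᵐ[μ] fun _ => (1 : ℝ) := by
  have hm : MemLp (fun _ : Ω => (1 : ℝ)) q μ := memLp_const 1
  obtain ⟨e, he⟩ := hJ.exists_eq hm.toLp
  have he1 : J e =ᵐ[μ] fun _ => (1 : ℝ) := he.trans hm.coeFn_toLp
  refine ⟨e, hJ.le_of_ae_le ?_, he1⟩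
  rw [map_zero]
  filter_upwards [he1, Lp.coeFn_zero ℝ 1 μ] with ω h1 h2
  rw [h1, h2]; norm_num

/-- The truncation errors decrease in `M` and tend to `0` almost everywhere, so their infimum in `E`
is `0` and order continuity applies. Thus elements bounded as functions approximate every positive
`u`. -/
theorem exists_norm_posPart_sub_smul_lt [IsOrderedAddMonoid E] [IsOrderedModule ℝ E]
    (hJ : IsLatticeEmbeddingAbove q J) (hE : IsOrderContinuousNorm E)
    {e : E} (he0 : 0 ≤ e) (he : J e =ᵐ[μ] fun _ => (1 : ℝ)) (u : E) {ε : ℝ} (hε : 0 < ε) :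
    ∃ M : ℕ, ‖(u - (M : ℝ) • e)⁺‖ < ε := by
  have hanti : Antitone fun M : ℕ => (u - (M : ℝ) • e)⁺ := fun m n hmn =>
    posPart_mono (sub_le_sub_left
      (smul_le_smul_of_nonneg_right (by exact_mod_cast hmn) he0) _)
  suffices hglb : IsGLB (Set.range fun M : ℕ => (u - (M : ℝ) • e)⁺) 0 by
    obtain ⟨x, ⟨M, rfl⟩, hx⟩ := hE _ (Set.range_nonempty _)
      (directedOn_range.mpr hanti.directed_ge) hglb ε hε
    exact ⟨M, hx⟩
  refine ⟨?_, fun w hw => hJ.le_of_ae_le ?_⟩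
  · rintro _ ⟨M, rfl⟩
    exact posPart_nonneg _
  have h1 : ∀ M : ℕ, ∀ᵐ ω ∂μ, J w ω ≤ max (J u ω - M) 0 := fun M => by
    have h2 : w ≤ (u - (M : ℝ) • e) ⊔ 0 := hw ⟨M, rfl⟩
    filter_upwards [hJ.ae_le_of_le h2, hJ.coeFn_sup (u - (M : ℝ) • e) 0,
      coeFn_sub J u ((M : ℝ) • e), coeFn_smul J M e, he, Lp.coeFn_zero ℝ 1 μ]
      with ω h2 h3 h4 h5 h6 h7
    rw [h3, h4, h5, h6, map_zero, h7] at h2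
    simpa using h2
  filter_upwards [ae_all_iff.mpr h1, Lp.coeFn_zero ℝ 1 μ] with ω h2 h3
  rw [map_zero, h3]
  obtain ⟨M, hM⟩ := exists_nat_ge (J u ω)
  simpa [hM] using h2 M

/-- The inclusion of `L_q` into `E` is continuous by the closed graph theorem, since both spaces sit
continuously and injectively in `L₁`. -/
theorem exists_norm_le_of_memLp [CompleteSpace E] [IsProbabilityMeasure μ] (hq : 1 ≤ q)
    (hJ : IsLatticeEmbeddingAbove q J) :
    ∃ C : ℝ, 0 < C ∧ ∀ x : E, MemLp (J x) q μ → ‖x‖ ≤ C * (eLpNorm (J x) q μ).toReal := by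
  have : Fact (1 ≤ q) := ⟨hq⟩
  choose I hI using hJ.exists_eq
  let L : Lp ℝ q μ →ₗ[ℝ] E :=
    { toFun := I
      map_add' := fun f g => hJ.injective <| Lp.ext <| by
        rw [map_add]
        filter_upwards [hI (f + g), hI f, hI g, Lp.coeFn_add f g, Lp.coeFn_add (J (I f)) (J (I g))]
          with ω h1 h2 h3 h4 h5
        rw [h1, h4, h5, Pi.add_apply, Pi.add_apply, h2, h3]
      map_smul' := fun c f => hJ.injective <| Lp.ext <| by
        rw [RingHom.id_apply]
        filter_upwards [hI (c • f), hI f, Lp.coeFn_smul c f, coeFn_smul J c (I f)]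
          with ω h1 h2 h3 h4
        rw [h1, h3, h4, Pi.smul_apply, h2, smul_eq_mul] }
  have hLI : ∀ f, J (L f) =ᵐ[μ] f := hI
  have hbd : ∀ f g : Lp ℝ q μ, ‖J (L f) - J (L g)‖ ≤ ‖f - g‖ := fun f g => by
    rw [Lp.norm_def, Lp.norm_def]
    refine ENNReal.toReal_mono (Lp.eLpNorm_ne_top _) ?_
    have : (J (L f) - J (L g) : Lp ℝ 1 μ) =ᵐ[μ] (f - g : Lp ℝ q μ) := by
      filter_upwards [Lp.coeFn_sub (J (L f)) (J (L g)), Lp.coeFn_sub f g, hLI f, hLI g]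
        with ω h1 h2 h3 h4
      rw [h1, h2, Pi.sub_apply, Pi.sub_apply, h3, h4]
    rw [eLpNorm_congr_ae this]
    exact eLpNorm_le_eLpNorm_of_exponent_le hq (Lp.aestronglyMeasurable _)
  have hcont : Continuous L := by
    refine L.continuous_of_seq_closed_graph fun f g y hf hy => hJ.injective ?_
    have h1 : Filter.Tendsto (fun n => J (L (f n))) Filter.atTop (nhds (J y)) :=
      (J.continuous.tendsto y).comp hy
    have h2 : Filter.Tendsto (fun n => J (L (f n))) Filter.atTop (nhds (J (L g))) := by
      rw [tendsto_iff_norm_sub_tendsto_zero] at hf ⊢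
      exact squeeze_zero (fun _ => norm_nonneg _) (fun n => hbd _ _) hf
    exact tendsto_nhds_unique h1 h2
  let L' : Lp ℝ q μ →L[ℝ] E := ⟨L, hcont⟩
  refine ⟨‖L'‖ + 1, by positivity, fun x hx => ?_⟩
  have h1 : L' hx.toLp = x := hJ.injective <| Lp.ext <| (hLI _).trans hx.coeFn_toLp
  calc ‖x‖ = ‖L' hx.toLp‖ := by rw [h1]
    _ ≤ ‖L'‖ * ‖hx.toLp‖ := L'.le_opNorm _
    _ ≤ (‖L'‖ + 1) * ‖hx.toLp‖ := by gcongr; linarith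
    _ = _ := by rw [Lp.norm_toLp]

/-- For some natural number `r`, the norm of `E` is dominated by that of `L_r`. -/
theorem exists_norm_le_integral_pow [CompleteSpace E] [IsProbabilityMeasure μ] (hq : 1 ≤ q)
    (hq' : q ≠ ∞) (hJ : IsLatticeEmbeddingAbove q J) :
    ∃ (r : ℕ) (C : ℝ), 2 ≤ r ∧ 0 < C ∧ ∀ (x : E) (K : ℝ),
      Integrable (fun ω => |J x ω| ^ r) μ → ∫ ω, |J x ω| ^ r ∂μ ≤ K →
        ‖x‖ ≤ C * K ^ (1 / (r : ℝ)) := by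
  obtain ⟨C, hC, h⟩ := hJ.exists_norm_le_of_memLp hq
  -- An integer exponent allows comparison of moments with the exponential series; `2 ≤ r` is needed
  -- in `min_pow_le_mul_sq_div`.
  refine ⟨max 2 ⌈q.toReal⌉₊, C, le_max_left _ _, hC, fun x K hint hK => ?_⟩
  set r := max 2 ⌈q.toReal⌉₊ with hr
  have hr0 : r ≠ 0 := by omega
  have hqr : q ≤ (r : ℝ≥0∞) := by
    rw [← ENNReal.ofReal_toReal hq', ← ENNReal.ofReal_natCast]
    exact ENNReal.ofReal_le_ofReal ((Nat.le_ceil _).trans (by exact_mod_cast le_max_right _ _))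
  have hmeas : AEStronglyMeasurable (J x) μ := Lp.aestronglyMeasurable _
  have hmem : MemLp (J x) r μ := by
    rw [← integrable_norm_rpow_iff hmeas (by exact_mod_cast hr0) (ENNReal.natCast_ne_top r)]
    simpa using hint
  have hnorm : (eLpNorm (J x) r μ).toReal ≤ K ^ (1 / (r : ℝ)) := by
    rw [hmem.eLpNorm_eq_integral_rpow_norm (by exact_mod_cast hr0) (ENNReal.natCast_ne_top r),
      ENNReal.toReal_ofReal (by positivity)]
    simp only [ENNReal.toReal_natCast, Real.norm_eq_abs, Real.rpow_natCast, one_div]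
    exact Real.rpow_le_rpow (integral_nonneg fun ω => by positivity) hK (by positivity)
  refine (h x (hmem.mono_exponent hqr)).trans ?_
  refine mul_le_mul_of_nonneg_left (le_trans ?_ hnorm) hC.le
  exact ENNReal.toReal_mono hmem.eLpNorm_ne_top (eLpNorm_le_eLpNorm_of_exponent_le hqr hmeas)

end IsLatticeEmbeddingAbove

/-! ### Summable multiplicative weights -/

section Weights

theorem sum_pow_quarter_le (s : Finset ℕ) : ∑ i ∈ s, (1 / 4 : ℝ) ^ (i + 1) ≤ 1 / 3 := by
  have h : HasSum (fun i : ℕ => (1 / 4 : ℝ) ^ (i + 1)) (1 / 3) := by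
    have := (hasSum_geometric_of_lt_one (by norm_num : (0 : ℝ) ≤ 1 / 4)
      (by norm_num)).mul_left (1 / 4)
    norm_num at this
    simpa [pow_succ'] using this
  exact sum_le_hasSum s (fun i _ => by positivity) h

theorem exp_half_le_two : Real.exp (1 / 2) ≤ 2 := by
  have h := Real.one_sub_le_exp_neg (1 / 2)
  rw [Real.exp_neg] at h
  have h0 := Real.exp_pos (1 / 2)
  have h1 : (1 / 2) * Real.exp (1 / 2) ≤ (Real.exp (1 / 2))⁻¹ * Real.exp (1 / 2) := by
    gcongr; linarith
  rw [inv_mul_cancel₀ h0.ne'] at h1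
  linarith

theorem exp_third_le_two : Real.exp (1 / 3) ≤ 2 :=
  (Real.exp_le_exp.mpr (by norm_num)).trans exp_half_le_two

/-- The sum is the expansion of `∏ (1 + 4⁻⁽ⁱ⁺¹⁾)`. Errors with these multiplicative weights
therefore add up over all subsets to a bound independent of `s`. -/
theorem sum_powerset_prod_pow_quarter_le (s : Finset ℕ) :
    ∑ S ∈ s.powerset, ∏ i ∈ S, (1 / 4 : ℝ) ^ (i + 1) ≤ 2 := by
  rw [← Finset.prod_one_add]
  refine (Real.prod_one_add_le_exp_sum s fun i => by positivity).trans ?_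
  exact (Real.exp_le_exp.mpr (sum_pow_quarter_le s)).trans exp_third_le_two

end Weights

/-! ### Real Riesz products and moment bounds -/

section RieszProduct

variable {Ω : Type*} [MeasurableSpace Ω] {μ : Measure Ω}

theorem ae_abs_prod_le {f : ℕ → Ω → ℝ} {B : ℝ}
    (hB : ∀ i, ∀ᵐ ω ∂μ, |f i ω| ≤ B) (S : Finset ℕ) :
    ∀ᵐ ω ∂μ, |∏ i ∈ S, f i ω| ≤ B ^ S.card := by
  filter_upwards [ae_all_iff.mpr hB] with ω h
  rw [Finset.abs_prod]
  exact (Finset.prod_le_prod (fun i _ => abs_nonneg _) fun i _ => h i).trans (by simp)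

theorem aestronglyMeasurable_finset_prod {f : ℕ → Ω → ℝ}
    (hm : ∀ i, AEStronglyMeasurable (f i) μ) (S : Finset ℕ) :
    AEStronglyMeasurable (fun ω => ∏ i ∈ S, f i ω) μ :=
  Finset.aestronglyMeasurable_fun_prod S fun i _ => hm i

variable [IsProbabilityMeasure μ]

theorem integrable_finset_prod {f : ℕ → Ω → ℝ} (hm : ∀ i, AEStronglyMeasurable (f i) μ) {B : ℝ}
    (hB : ∀ i, ∀ᵐ ω ∂μ, |f i ω| ≤ B) (S : Finset ℕ) :
    Integrable (fun ω => ∏ i ∈ S, f i ω) μ :=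
  Integrable.of_bound (aestronglyMeasurable_finset_prod hm S) _ (ae_abs_prod_le hB S)

/-- After expansion each subset contributes at most its weight, as the coefficients have modulus at
most one. -/
theorem integral_prod_one_add_mul_le {f : ℕ → Ω → ℝ} (hm : ∀ i, AEStronglyMeasurable (f i) μ)
    {B : ℝ} (hB : ∀ i, ∀ᵐ ω ∂μ, |f i ω| ≤ B)
    (hS : ∀ S : Finset ℕ, |∫ ω, ∏ i ∈ S, f i ω ∂μ| ≤ ∏ i ∈ S, (1 / 4 : ℝ) ^ (i + 1))
    (s : Finset ℕ) (a : ℕ → ℝ) (ha : ∀ i ∈ s, |a i| ≤ 1) :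
    ∫ ω, ∏ i ∈ s, (1 + a i * f i ω) ∂μ ≤ 2 := by
  simp_rw [Finset.prod_one_add, Finset.prod_mul_distrib]
  rw [integral_finsetSum _ fun S _ => (integrable_finset_prod hm hB S).const_mul _]
  refine (Finset.sum_le_sum fun S hSs => ?_).trans (sum_powerset_prod_pow_quarter_le s)
  rw [integral_const_mul]
  refine (le_abs_self _).trans ?_
  rw [abs_mul, Finset.abs_prod]
  refine (mul_le_of_le_one_left (abs_nonneg _) ?_).trans (hS S)
  exact Finset.prod_le_one (fun i _ => abs_nonneg _)
    fun i hi => ha i (Finset.mem_powerset.mp hSs hi)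

/-- Trades an exponential for a Riesz factor at quadratic cost: `exp x ≤ 1 + x + x²`, and `2 x² (1 +
x) ≥ x²` because `1 + x ≥ 1 / 2`. -/
theorem exp_le_one_add_mul_exp_sq {x : ℝ} (hx : |x| ≤ 1 / 2) :
    Real.exp x ≤ (1 + x) * Real.exp (2 * x ^ 2) := by
  have h1 := (abs_le.mp (Real.abs_exp_sub_one_sub_id_le (hx.trans (by norm_num)))).2
  have h2 := Real.add_one_le_exp (2 * x ^ 2)
  have h3 := (abs_le.mp hx).1
  have h4 : (1 + x) * (2 * x ^ 2 + 1) ≤ (1 + x) * Real.exp (2 * x ^ 2) :=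
    mul_le_mul_of_nonneg_left h2 (by linarith)
  nlinarith [sq_nonneg x]

/-- Exponential integrability of small combinations of a bounded sequence whose products have
rapidly decreasing integrals. -/
theorem integral_exp_sum_le {f : ℕ → Ω → ℝ} (hm : ∀ i, AEStronglyMeasurable (f i) μ) {B : ℝ}
    (hB : ∀ i, ∀ᵐ ω ∂μ, |f i ω| ≤ B) (hB1 : 1 ≤ B)
    (hS : ∀ S : Finset ℕ, |∫ ω, ∏ i ∈ S, f i ω ∂μ| ≤ ∏ i ∈ S, (1 / 4 : ℝ) ^ (i + 1))
    (s : Finset ℕ) (a : ℕ → ℝ) (ha : 4 * B ^ 2 * ∑ i ∈ s, a i ^ 2 ≤ 1) :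
    ∫ ω, Real.exp (∑ i ∈ s, a i * f i ω) ∂μ ≤ 4 := by
  have hB2 : 0 ≤ ∑ i ∈ s, a i ^ 2 := Finset.sum_nonneg fun i _ => sq_nonneg _
  -- The normalization of `a` serves twice: here it makes each `a i * f i` at most `1 / 2`, and
  -- below it bounds the quadratic cost by `exp (1 / 2)`.
  have hai : ∀ i ∈ s, |a i| * B ≤ 1 / 2 := fun i hi => by
    have h1 : a i ^ 2 ≤ ∑ i ∈ s, a i ^ 2 :=
      Finset.single_le_sum (f := fun i => a i ^ 2) (fun i _ => sq_nonneg _) hi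
    have h2 : (|a i| * B) ^ 2 ≤ (1 / 2) ^ 2 := by
      rw [mul_pow, sq_abs]
      nlinarith [sq_nonneg B]
    exact le_of_sq_le_sq h2 (by norm_num)
  have hpt : ∀ᵐ ω ∂μ, Real.exp (∑ i ∈ s, a i * f i ω) ≤
      2 * ∏ i ∈ s, (1 + a i * f i ω) := by
    filter_upwards [ae_all_iff.mpr hB] with ω h
    have h0 : ∀ i ∈ s, |a i * f i ω| ≤ 1 / 2 := fun i hi => by
      rw [abs_mul]
      exact (mul_le_mul_of_nonneg_left (h i) (abs_nonneg _)).trans (hai i hi)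
    have hprod : 0 ≤ ∏ i ∈ s, (1 + a i * f i ω) := Finset.prod_nonneg fun i hi => by
      linarith [(abs_le.mp (h0 i hi)).1]
    have hexp : Real.exp (∑ i ∈ s, 2 * (a i * f i ω) ^ 2) ≤ 2 := by
      have h1 : ∑ i ∈ s, 2 * (a i * f i ω) ^ 2 ≤ 2 * B ^ 2 * ∑ i ∈ s, a i ^ 2 := by
        rw [Finset.mul_sum]
        refine Finset.sum_le_sum fun i _ => ?_
        have : f i ω ^ 2 ≤ B ^ 2 := sq_le_sq' (abs_le.mp (h i)).1 (abs_le.mp (h i)).2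
        rw [mul_pow]
        nlinarith [sq_nonneg (a i)]
      exact (Real.exp_le_exp.mpr (by linarith)).trans exp_half_le_two
    rw [Real.exp_sum]
    calc ∏ i ∈ s, Real.exp (a i * f i ω)
        ≤ ∏ i ∈ s, ((1 + a i * f i ω) * Real.exp (2 * (a i * f i ω) ^ 2)) :=
          Finset.prod_le_prod (fun i _ => (Real.exp_pos _).le)
            fun i hi => exp_le_one_add_mul_exp_sq (h0 i hi)
      _ = (∏ i ∈ s, (1 + a i * f i ω)) * Real.exp (∑ i ∈ s, 2 * (a i * f i ω) ^ 2) := by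
          rw [Finset.prod_mul_distrib, Real.exp_sum]
      _ ≤ (∏ i ∈ s, (1 + a i * f i ω)) * 2 := mul_le_mul_of_nonneg_left hexp hprod
      _ = _ := mul_comm _ _
  have hint : Integrable (fun ω => ∏ i ∈ s, (1 + a i * f i ω)) μ := by
    simp_rw [Finset.prod_one_add, Finset.prod_mul_distrib]
    exact integrable_finsetSum _ fun S _ => (integrable_finset_prod hm hB S).const_mul _
  have hle1 : ∀ i ∈ s, |a i| ≤ 1 := fun i hi => by
    nlinarith [hai i hi, abs_nonneg (a i)]
  calc ∫ ω, Real.exp (∑ i ∈ s, a i * f i ω) ∂μ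
      ≤ ∫ ω, 2 * ∏ i ∈ s, (1 + a i * f i ω) ∂μ :=
        integral_mono_of_nonneg (ae_of_all _ fun ω => (Real.exp_pos _).le) (hint.const_mul 2) hpt
    _ = 2 * ∫ ω, ∏ i ∈ s, (1 + a i * f i ω) ∂μ := integral_const_mul _ _
    _ ≤ 4 := by linarith [integral_prod_one_add_mul_le hm hB hS s a hle1]

theorem integrable_of_comp_sum {f : ℕ → Ω → ℝ} (hm : ∀ i, AEStronglyMeasurable (f i) μ) {B : ℝ}
    (hB : ∀ i, ∀ᵐ ω ∂μ, |f i ω| ≤ B) (s : Finset ℕ) (a : ℕ → ℝ) {g : ℝ → ℝ} (hg : Continuous g) :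
    Integrable (fun ω => g (∑ i ∈ s, a i * f i ω)) μ := by
  obtain ⟨K, hK⟩ := (isCompact_Icc (a := -∑ i ∈ s, |a i| * B)
    (b := ∑ i ∈ s, |a i| * B)).exists_bound_of_continuousOn hg.continuousOn
  refine Integrable.of_bound (hg.comp_aestronglyMeasurable
    (Finset.aestronglyMeasurable_fun_sum s fun i _ => (hm i).const_mul _)) K ?_
  filter_upwards [ae_all_iff.mpr hB] with ω h
  refine hK _ (abs_le.mp ((Finset.abs_sum_le_sum_abs _ _).trans (Finset.sum_le_sum fun i _ => ?_)))
  rw [abs_mul]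
  exact mul_le_mul_of_nonneg_left (h i) (abs_nonneg _)

/-- From `|t| ^ r ≤ r! (exp t + exp (-t))` and the exponential bound applied to `a` and `-a`. -/
theorem integral_abs_sum_pow_le {f : ℕ → Ω → ℝ} (hm : ∀ i, AEStronglyMeasurable (f i) μ) {B : ℝ}
    (hB : ∀ i, ∀ᵐ ω ∂μ, |f i ω| ≤ B) (hB1 : 1 ≤ B)
    (hS : ∀ S : Finset ℕ, |∫ ω, ∏ i ∈ S, f i ω ∂μ| ≤ ∏ i ∈ S, (1 / 4 : ℝ) ^ (i + 1))
    (s : Finset ℕ) (a : ℕ → ℝ) (ha : 4 * B ^ 2 * ∑ i ∈ s, a i ^ 2 ≤ 1) (r : ℕ) :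
    ∫ ω, |∑ i ∈ s, a i * f i ω| ^ r ∂μ ≤ 8 * r.factorial := by
  have h1 := integral_exp_sum_le hm hB hB1 hS s a ha
  have h2 := integral_exp_sum_le hm hB hB1 hS s (fun i => -a i) (by simpa using ha)
  have hi1 := integrable_of_comp_sum hm hB s a Real.continuous_exp
  have hi2 := integrable_of_comp_sum hm hB s (fun i => -a i) Real.continuous_exp
  calc ∫ ω, |∑ i ∈ s, a i * f i ω| ^ r ∂μ
      ≤ ∫ ω, (r.factorial : ℝ) * (Real.exp (∑ i ∈ s, a i * f i ω) +
          Real.exp (∑ i ∈ s, -a i * f i ω)) ∂μ := by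
        refine integral_mono (integrable_of_comp_sum hm hB s a (g := fun t => |t| ^ r) (by fun_prop))
          ((hi1.add hi2).const_mul _) fun ω => ?_
        have h3 := Real.pow_div_factorial_le_exp _ (abs_nonneg (∑ i ∈ s, a i * f i ω)) r
        rw [div_le_iff₀' (by positivity)] at h3
        refine h3.trans (mul_le_mul_of_nonneg_left ?_ (by positivity))
        simp only [neg_mul, Finset.sum_neg_distrib]
        rcases abs_cases (∑ i ∈ s, a i * f i ω) with ⟨h, _⟩ | ⟨h, _⟩ <;> rw [h]
        · linarith [Real.exp_pos (-∑ i ∈ s, a i * f i ω)]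
        · linarith [Real.exp_pos (∑ i ∈ s, a i * f i ω)]
    _ = r.factorial * (∫ ω, Real.exp (∑ i ∈ s, a i * f i ω) ∂μ +
          ∫ ω, Real.exp (∑ i ∈ s, -a i * f i ω) ∂μ) := by
        rw [integral_const_mul, integral_add hi1 hi2]
    _ ≤ 8 * r.factorial := by nlinarith [(Nat.cast_nonneg r.factorial : (0 : ℝ) ≤ _)]

end RieszProduct

/-- `x` is dominated by the unit vector basis of `ℓ₂`. -/
def HasUpperTwoEstimate {E : Type*} [NormedAddCommGroup E] [NormedSpace ℝ E] (x : ℕ → E) : Prop :=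
  ∃ C : ℝ, 0 < C ∧ ∀ (s : Finset ℕ) (a : ℕ → ℝ),
    ‖∑ k ∈ s, a k • x k‖ ≤ C * √(∑ k ∈ s, a k ^ 2)

/-- A sequence that is bounded as functions, and whose products have rapidly decreasing integrals,
is dominated by the unit vector basis of `ℓ₂`. -/
theorem IsLatticeEmbeddingAbove.hasUpperTwoEstimate {E : Type*} [NormedAddCommGroup E] [Lattice E]
    [NormedSpace ℝ E] [CompleteSpace E] {Ω : Type*} [MeasurableSpace Ω]
    {μ : Measure Ω} [IsProbabilityMeasure μ] {q : ℝ≥0∞} {J : E →L[ℝ] Lp ℝ 1 μ} (hq : 1 ≤ q)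
    (hq' : q ≠ ∞) (hJ : IsLatticeEmbeddingAbove q J) (x : ℕ → E) {B : ℝ} (hB1 : 1 ≤ B)
    (hB : ∀ i, ∀ᵐ ω ∂μ, |J (x i) ω| ≤ B)
    (hS : ∀ S : Finset ℕ, |∫ ω, ∏ i ∈ S, J (x i) ω ∂μ| ≤ ∏ i ∈ S, (1 / 4 : ℝ) ^ (i + 1)) :
    HasUpperTwoEstimate x := by
  obtain ⟨r, C, hr, hC, hK⟩ := hJ.exists_norm_le_integral_pow hq hq'
  have hm : ∀ i, AEStronglyMeasurable (J (x i)) μ := fun i => Lp.aestronglyMeasurable _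
  refine ⟨2 * B * (C * (8 * r.factorial : ℝ) ^ (1 / (r : ℝ))), by positivity, fun s a => ?_⟩
  set A := √(∑ k ∈ s, a k ^ 2) with hA
  have hsum : 0 ≤ ∑ k ∈ s, a k ^ 2 := Finset.sum_nonneg fun i _ => sq_nonneg _
  have hA2 : A ^ 2 = ∑ k ∈ s, a k ^ 2 := Real.sq_sqrt hsum
  rcases (Real.sqrt_nonneg (∑ k ∈ s, a k ^ 2)).eq_or_lt with h0 | hpos
  · have h1 : ∀ k ∈ s, a k ^ 2 = 0 :=
      (Finset.sum_eq_zero_iff_of_nonneg fun i _ => sq_nonneg _).mp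
        (by rw [← hA2, hA, ← h0]; norm_num)
    rw [Finset.sum_eq_zero fun k hk => by rw [pow_eq_zero_iff two_ne_zero |>.mp (h1 k hk), zero_smul],
      norm_zero, hA, ← h0, mul_zero]
  rw [← hA] at hpos
  -- Rescaled so that `4 B² ∑ b k ^ 2 = 1`, the largest value the moment bound allows.
  set b : ℕ → ℝ := fun k => a k / (2 * B * A) with hb
  have hbsum : 4 * B ^ 2 * ∑ k ∈ s, b k ^ 2 ≤ 1 := by
    simp only [hb, div_pow]
    rw [← Finset.sum_div, ← hA2]
    apply le_of_eq
    field_simp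
    norm_num
  have hJb := coeFn_sum_smul J s b x
  have h2 := hK (∑ k ∈ s, b k • x k) (8 * r.factorial)
    ((integrable_of_comp_sum hm hB s b (g := fun t => |t| ^ r) (by fun_prop)).congr
      (by filter_upwards [hJb] with ω h; rw [h]))
    ((integral_congr_ae (by filter_upwards [hJb] with ω h; rw [h])).trans_le
      (integral_abs_sum_pow_le hm hB hB1 hS s b hbsum r))
  have h3 : ∑ k ∈ s, a k • x k = (2 * B * A) • ∑ k ∈ s, b k • x k := by
    rw [Finset.smul_sum]
    refine Finset.sum_congr rfl fun k _ => ?_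
    rw [smul_smul, hb]
    congr 1
    field_simp
  rw [h3, norm_smul, Real.norm_of_nonneg (by positivity)]
  calc 2 * B * A * ‖∑ k ∈ s, b k • x k‖
      ≤ 2 * B * A * (C * (8 * r.factorial : ℝ) ^ (1 / (r : ℝ))) := by gcongr
    _ = _ := by ring

/-! ### Imaginary Riesz products and lower bounds in `L₁` -/

section ImaginaryRieszProduct

/-- The imaginary unit makes the modulus quadratic in `t`, so the whole product is controlled by the
`ℓ₂` norm of the coefficients. -/
theorem norm_one_add_I_mul_le (t : ℝ) : ‖(1 : ℂ) + Complex.I * t‖ ≤ Real.exp (t ^ 2 / 2) := by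
  have h1 : ‖(1 : ℂ) + Complex.I * t‖ = √(1 + t ^ 2) := by
    rw [Complex.norm_eq_sqrt_sq_add_sq]
    simp
  rw [h1]
  refine Real.sqrt_le_iff.mpr ⟨(Real.exp_pos _).le, ?_⟩
  rw [← Real.exp_nat_mul]
  have := Real.add_one_le_exp (t ^ 2)
  have h2 : ((2 : ℕ) : ℝ) * (t ^ 2 / 2) = t ^ 2 := by push_cast; ring
  rw [h2]; linarith

/-- Erasing `j` amounts to giving `j` the weight `1`, which contributes one extra factor `2`. -/
theorem sum_powerset_prod_erase_le (s : Finset ℕ) (j : ℕ) :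
    ∑ S ∈ s.powerset, ∏ i ∈ S.erase j, (1 / 4 : ℝ) ^ (i + 1) ≤ 4 := by
  set ρ : ℕ → ℝ := fun i => if i = j then 1 else (1 / 4 : ℝ) ^ (i + 1) with hρ
  have hρ0 : ∀ i, 0 ≤ ρ i := fun i => by
    simp only [hρ]; split_ifs <;> positivity
  have h1 : ∀ S : Finset ℕ, ∏ i ∈ S.erase j, (1 / 4 : ℝ) ^ (i + 1) = ∏ i ∈ S, ρ i := fun S => by
    have h2 : ∏ i ∈ S.erase j, ρ i = ∏ i ∈ S, ρ i :=
      Finset.prod_erase S (by simp [hρ])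
    rw [← h2]
    exact Finset.prod_congr rfl fun i hi => by simp [hρ, Finset.ne_of_mem_erase hi]
  simp_rw [h1]
  rw [← Finset.prod_one_add]
  have h3 : ∏ i ∈ s, (1 + ρ i) ≤ ∏ i ∈ insert j s, (1 + ρ i) := by
    by_cases hj : j ∈ s
    · rw [Finset.insert_eq_of_mem hj]
    · rw [Finset.prod_insert hj]
      exact le_mul_of_one_le_left (Finset.prod_nonneg fun i _ => by linarith [hρ0 i])
        (by linarith [hρ0 j])
  refine h3.trans ?_
  rw [← Finset.mul_prod_erase _ _ (Finset.mem_insert_self j s)]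
  have h4 : ∏ i ∈ (insert j s).erase j, (1 + ρ i) ≤ 2 := by
    calc ∏ i ∈ (insert j s).erase j, (1 + ρ i)
        = ∏ i ∈ (insert j s).erase j, (1 + (1 / 4 : ℝ) ^ (i + 1)) :=
          Finset.prod_congr rfl fun i hi => by simp [hρ, Finset.ne_of_mem_erase hi]
      _ ≤ 2 := (Real.prod_one_add_le_exp_sum _ fun i => by positivity).trans
          ((Real.exp_le_exp.mpr (sum_pow_quarter_le _)).trans exp_third_le_two)
  have h5 : ρ j = 1 := by simp [hρ]
  rw [h5]; linarith

variable {Ω : Type*} [MeasurableSpace Ω] {μ : Measure Ω}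

theorem integrable_mul_finset_prod {y : Ω → ℝ} (hy : Integrable y μ) {w : ℕ → Ω → ℝ}
    (hw : ∀ i, AEStronglyMeasurable (w i) μ) (hw1 : ∀ i ω, |w i ω| ≤ 1) (S : Finset ℕ) :
    Integrable (fun ω => y ω * ∏ i ∈ S, w i ω) μ :=
  hy.mul_bdd (c := 1) (aestronglyMeasurable_finset_prod hw S) (ae_of_all _ fun ω => by
    rw [Real.norm_eq_abs, Finset.abs_prod]
    exact Finset.prod_le_one (fun i _ => abs_nonneg _) fun i _ => hw1 i ω)

/-- Expanding the integral of `∑ a j • y j` against the Riesz product `∏ (1 + I * a k * w k)`. -/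
theorem sum_sum_integral_le {y w : ℕ → Ω → ℝ} (hy : ∀ i, Integrable (y i) μ)
    (hw : ∀ i, AEStronglyMeasurable (w i) μ) (hw1 : ∀ i ω, |w i ω| ≤ 1)
    (s : Finset ℕ) (a : ℕ → ℝ) (ha : ∑ j ∈ s, a j ^ 2 = 1) :
    ‖∑ j ∈ s, ∑ S ∈ s.powerset, ((a j : ℂ) * ∏ i ∈ S, (Complex.I * (a i : ℂ))) *
      ((∫ ω, y j ω * ∏ i ∈ S, w i ω ∂μ : ℝ) : ℂ)‖ ≤ 2 * ∫ ω, |∑ j ∈ s, a j * y j ω| ∂μ := by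
  have hint : ∀ j S, Integrable (fun ω => ((a j : ℂ) * ∏ i ∈ S, (Complex.I * (a i : ℂ))) *
      ((y j ω * ∏ i ∈ S, w i ω : ℝ) : ℂ)) μ := fun j S =>
    ((integrable_mul_finset_prod (hy j) hw hw1 S).ofReal (𝕜 := ℂ)).const_mul _
  have hG : ∀ ω, ∑ j ∈ s, ∑ S ∈ s.powerset, ((a j : ℂ) * ∏ i ∈ S, (Complex.I * (a i : ℂ))) *
      ((y j ω * ∏ i ∈ S, w i ω : ℝ) : ℂ) =
      ((∑ j ∈ s, a j * y j ω : ℝ) : ℂ) * ∏ k ∈ s, (1 + Complex.I * (a k * w k ω : ℝ)) := by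
    intro ω
    rw [Finset.prod_one_add, Complex.ofReal_sum, Finset.sum_mul]
    refine Finset.sum_congr rfl fun j _ => ?_
    rw [Finset.mul_sum]
    refine Finset.sum_congr rfl fun S _ => ?_
    push_cast
    simp only [Finset.prod_mul_distrib]
    ring
  have hcalc : ∑ j ∈ s, ∑ S ∈ s.powerset, ((a j : ℂ) * ∏ i ∈ S, (Complex.I * (a i : ℂ))) *
      ((∫ ω, y j ω * ∏ i ∈ S, w i ω ∂μ : ℝ) : ℂ) =
      ∫ ω, ((∑ j ∈ s, a j * y j ω : ℝ) : ℂ) * ∏ k ∈ s, (1 + Complex.I * (a k * w k ω : ℝ)) ∂μ := by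
    simp_rw [← hG]
    rw [integral_finsetSum _ fun j _ => integrable_finsetSum _ fun S _ => hint j S]
    refine Finset.sum_congr rfl fun j _ => ?_
    rw [integral_finsetSum _ fun S _ => hint j S]
    refine Finset.sum_congr rfl fun S _ => ?_
    rw [integral_const_mul, integral_complex_ofReal]
  have hGn : ∀ ω, ‖∏ k ∈ s, ((1 : ℂ) + Complex.I * (a k * w k ω : ℝ))‖ ≤ 2 := by
    intro ω
    rw [norm_prod]
    calc ∏ k ∈ s, ‖(1 : ℂ) + Complex.I * (a k * w k ω : ℝ)‖
        ≤ ∏ k ∈ s, Real.exp ((a k * w k ω) ^ 2 / 2) :=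
          Finset.prod_le_prod (fun _ _ => norm_nonneg _) fun k _ => norm_one_add_I_mul_le _
      _ = Real.exp (∑ k ∈ s, (a k * w k ω) ^ 2 / 2) := (Real.exp_sum _ _).symm
      _ ≤ Real.exp (1 / 2) := by
          refine Real.exp_le_exp.mpr ?_
          rw [← ha, Finset.sum_div]
          refine Finset.sum_le_sum fun k _ => ?_
          have h1 : (w k ω) ^ 2 ≤ 1 := (sq_le_one_iff_abs_le_one _).mpr (hw1 k ω)
          rw [mul_pow]
          nlinarith [sq_nonneg (a k)]
      _ ≤ 2 := exp_half_le_two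
  rw [hcalc, ← integral_const_mul]
  refine (norm_integral_le_integral_norm _).trans (integral_mono_of_nonneg
    (ae_of_all _ fun ω => norm_nonneg _)
    ((integrable_finsetSum s fun j _ => (hy j).const_mul (a j)).abs.const_mul 2)
    (ae_of_all _ fun ω => ?_))
  simp only [norm_mul, Complex.norm_real, Real.norm_eq_abs]
  rw [mul_comm]
  exact mul_le_mul_of_nonneg_right (hGn ω) (abs_nonneg _)

/-- Duality against the bounded product `∏ (1 + I a k w k)`: the diagonal pairs `(j, {j})`
contribute `I a j ^ 2 ∫ y j w j`, of total imaginary part at least `δ`, and all other pairs are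
errors. When `j` is the largest element of `S ≠ {j}` the integral carries no weight for `j`, but the
coefficient contains `a j ^ 2`, which is summable. The errors total at most `(2 / 3 + 8) η ≤ δ / 2`.
-/
theorem le_integral_abs_sum {y w : ℕ → Ω → ℝ} (hy : ∀ i, Integrable (y i) μ)
    (hw : ∀ i, AEStronglyMeasurable (w i) μ) (hw1 : ∀ i ω, |w i ω| ≤ 1) {δ η : ℝ} (hη : 0 ≤ η)
    (hηδ : 18 * η ≤ δ)
    (h1 : ∀ (j : ℕ) (S : Finset ℕ), ¬ (j ∈ S ∧ ∀ i ∈ S, i ≤ j) →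
      |∫ ω, y j ω * ∏ i ∈ S, w i ω ∂μ| ≤
        η * ((1 / 4 : ℝ) ^ (j + 1) * ∏ i ∈ S, (1 / 4 : ℝ) ^ (i + 1)))
    (h2 : ∀ (j : ℕ) (S : Finset ℕ), j ∈ S → (∀ i ∈ S, i ≤ j) → S ≠ {j} →
      |∫ ω, y j ω * ∏ i ∈ S, w i ω ∂μ| ≤ 2 * η * ∏ i ∈ S.erase j, (1 / 4 : ℝ) ^ (i + 1))
    (h3 : ∀ j, δ ≤ ∫ ω, y j ω * w j ω ∂μ)
    (s : Finset ℕ) (a : ℕ → ℝ) (ha : ∑ j ∈ s, a j ^ 2 = 1) :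
    δ / 4 ≤ ∫ ω, |∑ j ∈ s, a j * y j ω| ∂μ := by
  have hmain := sum_sum_integral_le hy hw hw1 s a ha
  set c : ℕ → Finset ℕ → ℝ := fun j S => ∫ ω, y j ω * ∏ i ∈ S, w i ω ∂μ with hc
  set D : ℕ → Finset ℕ → ℂ := fun j S =>
    ((a j : ℂ) * ∏ i ∈ S, (Complex.I * (a i : ℂ))) * (c j S : ℂ) with hD
  change ‖∑ j ∈ s, ∑ S ∈ s.powerset, D j S‖ ≤ _ at hmain
  have hsq : ∀ j ∈ s, a j ^ 2 ≤ 1 := fun j hj => by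
    rw [← ha]
    exact Finset.single_le_sum (f := fun i => a i ^ 2) (fun i _ => sq_nonneg _) hj
  have ha1 : ∀ j ∈ s, |a j| ≤ 1 := fun j hj => (sq_le_one_iff_abs_le_one _).mp (hsq j hj)
  have hDn : ∀ j S, ‖D j S‖ = |a j| * (∏ i ∈ S, |a i|) * |c j S| := fun j S => by
    simp [hD, norm_prod]
  have hPle : ∀ S ⊆ s, ∏ i ∈ S, |a i| ≤ 1 := fun S hS =>
    Finset.prod_le_one (fun i _ => abs_nonneg _) fun i hi => ha1 i (hS hi)
  have hP0 : ∀ S : Finset ℕ, 0 ≤ ∏ i ∈ S, |a i| := fun S =>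
    Finset.prod_nonneg fun i _ => abs_nonneg _
  -- The two kinds of error are bounded by their sum, so that no case split is needed when summing
  -- over `S`.
  have hbound : ∀ j ∈ s, ∀ S ⊆ s, S ≠ {j} → ‖D j S‖ ≤
      η * ((1 / 4 : ℝ) ^ (j + 1) * ∏ i ∈ S, (1 / 4 : ℝ) ^ (i + 1)) +
        a j ^ 2 * (2 * η * ∏ i ∈ S.erase j, (1 / 4 : ℝ) ^ (i + 1)) := by
    intro j hj S hS hne
    have hp1 : 0 ≤ η * ((1 / 4 : ℝ) ^ (j + 1) * ∏ i ∈ S, (1 / 4 : ℝ) ^ (i + 1)) := by positivity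
    have hp2 : 0 ≤ 2 * η * ∏ i ∈ S.erase j, (1 / 4 : ℝ) ^ (i + 1) := by positivity
    rw [hDn]
    by_cases hcase : j ∈ S ∧ ∀ i ∈ S, i ≤ j
    · have h4 : |a j| * ∏ i ∈ S, |a i| ≤ a j ^ 2 := by
        rw [← Finset.mul_prod_erase _ _ hcase.1, ← mul_assoc, ← sq, sq_abs]
        exact mul_le_of_le_one_right (sq_nonneg _)
          (hPle _ ((Finset.erase_subset _ _).trans hS))
      have h5 := h2 j S hcase.1 hcase.2 hne
      have := mul_le_mul h4 h5 (abs_nonneg _) (sq_nonneg _)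
      linarith
    · have h5 := h1 j S hcase
      have h4 : |a j| * ∏ i ∈ S, |a i| ≤ 1 := mul_le_one₀ (ha1 j hj) (hP0 S) (hPle S hS)
      have h6 := mul_le_of_le_one_left (abs_nonneg (c j S)) h4
      have h7 := mul_nonneg (sq_nonneg (a j)) hp2
      linarith
  have hdiag : ∀ j, (D j {j}).im = a j ^ 2 * ∫ ω, y j ω * w j ω ∂μ := fun j => by
    have : D j {j} = ((a j ^ 2 * ∫ ω, y j ω * w j ω ∂μ : ℝ) : ℂ) * Complex.I := by
      simp only [hD, hc, Finset.prod_singleton]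
      push_cast
      ring
    rw [this, Complex.mul_I_im, Complex.ofReal_re]
  have hrow : ∀ j ∈ s, a j ^ 2 * δ - (2 * η * (1 / 4 : ℝ) ^ (j + 1) + 8 * η * a j ^ 2) ≤
      (∑ S ∈ s.powerset, D j S).im := by
    intro j hj
    have hjm : {j} ∈ s.powerset := by simpa using hj
    rw [← Finset.add_sum_erase _ _ hjm, Complex.add_im, hdiag]
    have h4 : ‖∑ S ∈ s.powerset.erase {j}, D j S‖ ≤
        2 * η * (1 / 4 : ℝ) ^ (j + 1) + 8 * η * a j ^ 2 := by
      calc ‖∑ S ∈ s.powerset.erase {j}, D j S‖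
          ≤ ∑ S ∈ s.powerset.erase {j},
            (η * ((1 / 4 : ℝ) ^ (j + 1) * ∏ i ∈ S, (1 / 4 : ℝ) ^ (i + 1)) +
              a j ^ 2 * (2 * η * ∏ i ∈ S.erase j, (1 / 4 : ℝ) ^ (i + 1))) :=
            norm_sum_le_of_le _ fun S hS => hbound j hj S
              (Finset.mem_powerset.mp (Finset.mem_of_mem_erase hS)) (Finset.ne_of_mem_erase hS)
        _ ≤ ∑ S ∈ s.powerset,
            (η * ((1 / 4 : ℝ) ^ (j + 1) * ∏ i ∈ S, (1 / 4 : ℝ) ^ (i + 1)) +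
              a j ^ 2 * (2 * η * ∏ i ∈ S.erase j, (1 / 4 : ℝ) ^ (i + 1))) :=
            Finset.sum_le_sum_of_subset_of_nonneg (Finset.erase_subset _ _)
              fun S _ _ => by positivity
        _ = η * (1 / 4 : ℝ) ^ (j + 1) * ∑ S ∈ s.powerset, ∏ i ∈ S, (1 / 4 : ℝ) ^ (i + 1) +
            a j ^ 2 * (2 * η) * ∑ S ∈ s.powerset, ∏ i ∈ S.erase j, (1 / 4 : ℝ) ^ (i + 1) := by
            rw [Finset.sum_add_distrib, Finset.mul_sum, Finset.mul_sum]
            simp only [mul_assoc]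
        _ ≤ η * (1 / 4 : ℝ) ^ (j + 1) * 2 + a j ^ 2 * (2 * η) * 4 := by
            gcongr
            · exact sum_powerset_prod_pow_quarter_le s
            · exact sum_powerset_prod_erase_le s j
        _ = _ := by ring
    have h5 := (abs_le.mp ((Complex.abs_im_le_norm _).trans h4)).1
    have h6 := mul_le_mul_of_nonneg_left (h3 j) (sq_nonneg (a j))
    linarith
  have htot : δ / 2 ≤ (∑ j ∈ s, ∑ S ∈ s.powerset, D j S).im := by
    rw [Complex.im_sum]
    refine le_trans ?_ (Finset.sum_le_sum hrow)
    rw [Finset.sum_sub_distrib, Finset.sum_add_distrib, ← Finset.sum_mul, ← Finset.mul_sum,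
      ← Finset.mul_sum, ha]
    have := mul_le_mul_of_nonneg_left (sum_pow_quarter_le s) (by positivity : 0 ≤ 2 * η)
    linarith
  have h7 := (Complex.abs_im_le_norm (∑ j ∈ s, ∑ S ∈ s.powerset, D j S)).trans hmain
  have h8 := le_abs_self (∑ j ∈ s, ∑ S ∈ s.powerset, D j S).im
  linarith

end ImaginaryRieszProduct

/-! ### Extracting a subsequence with a lower `L₁` estimate -/

section LowerEstimate

open Filter Topology

/-- Limits along one fixed ultrafilter exist for all test functions at once, which avoids diagonal
subsequences. -/
theorem Ultrafilter.exists_tendsto_of_abs_le {ι : Type*} (U : Ultrafilter ι) {b : ι → ℝ} {K : ℝ}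
    (hb : ∀ n, |b n| ≤ K) : ∃ L, Tendsto b U (𝓝 L) := by
  obtain ⟨L, -, hL⟩ := (isCompact_Icc (a := -K) (b := K)).ultrafilter_le_nhds (U.map b)
    (le_principal_iff.mpr (Filter.mem_map.mpr
      (Filter.univ_mem' fun n => abs_le.mp (hb n))))
  exact ⟨L, hL⟩

/-- The Cauchy property along `U`, in the order of choice used later: first an index `m`, then `n`
depending on it. Differences are thus asymptotically null with no weak limit to identify. -/
theorem eventually_curry_abs_sub_lt {U : Filter ℕ} {b : ℕ → ℝ} {L : ℝ}
    (hb : Tendsto b U (𝓝 L)) {ε : ℝ} (hε : 0 < ε) :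
    ∀ᶠ i in U.curry U, |b i.2 - b i.1| < ε := by
  have h : ∀ᶠ n in U, |b n - L| < ε / 2 := by
    have := hb (Metric.ball_mem_nhds L (half_pos hε))
    filter_upwards [this] with n hn
    simpa [Real.dist_eq] using hn
  rw [eventually_curry_iff]
  filter_upwards [h] with m hm
  filter_upwards [h] with n hn
  have := abs_sub_le (b n) L (b m)
  rw [abs_sub_comm L] at this
  linarith

theorem abs_div_one_add_sq_le (t : ℝ) : |t / (1 + t ^ 2)| ≤ 1 / 2 := by
  have h : 0 < 1 + t ^ 2 := by positivity
  rw [abs_div, abs_of_pos h, div_le_iff₀ h, ← sq_abs t]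
  nlinarith [sq_nonneg (|t| - 1)]

theorem sq_div_one_add_sq_mem (t : ℝ) : 0 ≤ t ^ 2 / (1 + t ^ 2) ∧ t ^ 2 / (1 + t ^ 2) ≤ 1 := by
  have h : 0 < 1 + t ^ 2 := by positivity
  exact ⟨by positivity, (div_le_one h).mpr (by linarith)⟩

variable {Ω : Type*} [MeasurableSpace Ω] {μ : Measure Ω} [IsProbabilityMeasure μ]

/-- The test functions are differences of the bounded functions `y n / (1 + y n ^ 2)`. Against `y
n`, the later term gives `y n ^ 2 / (1 + y n ^ 2)`, with integral at least `δ`, and the earlier one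
is negligible by weak nullity. Choosing the pairs one at a time makes all mixed integrals small. -/
theorem exists_subseq_le_integral_abs_sum {y : ℕ → Ω → ℝ} (hy : ∀ n, Integrable (y n) μ)
    (hweak : ∀ g : Ω → ℝ, AEStronglyMeasurable g μ → (∀ ω, |g ω| ≤ 1) →
      Tendsto (fun n => ∫ ω, y n ω * g ω ∂μ) atTop (𝓝 0))
    (U : Ultrafilter ℕ) (hU : (U : Filter ℕ) ≤ atTop) {δ : ℝ} (hδ0 : 0 < δ)
    (hδ : ∀ᶠ n in (U : Filter ℕ), δ ≤ ∫ ω, y n ω ^ 2 / (1 + y n ω ^ 2) ∂μ) :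
    ∃ φ : ℕ → ℕ, StrictMono φ ∧ ∀ (s : Finset ℕ) (a : ℕ → ℝ), ∑ j ∈ s, a j ^ 2 = 1 →
      δ / 8 ≤ ∫ ω, |∑ j ∈ s, a j * y (φ j) ω| ∂μ := by
  set sg : ℕ → Ω → ℝ := fun n ω => y n ω / (1 + y n ω ^ 2) with hsg
  set p : ℕ → Ω → ℝ := fun n ω => y n ω ^ 2 / (1 + y n ω ^ 2) with hp
  set F : Filter (ℕ × ℕ) := (U : Filter ℕ).curry U with hF
  set Y : ℕ × ℕ → Ω → ℝ := fun i => y i.2 with hY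
  set W : ℕ × ℕ → Ω → ℝ := fun i ω => sg i.2 ω - sg i.1 ω with hW
  have hsgm : ∀ n, AEStronglyMeasurable (sg n) μ := fun n =>
    (((hy n).aestronglyMeasurable.aemeasurable).div
      (((hy n).aestronglyMeasurable.aemeasurable.pow_const 2).const_add 1)).aestronglyMeasurable
  have hpm : ∀ n, AEStronglyMeasurable (p n) μ := fun n =>
    (((hy n).aestronglyMeasurable.aemeasurable.pow_const 2).div
      (((hy n).aestronglyMeasurable.aemeasurable.pow_const 2).const_add 1)).aestronglyMeasurable
  have hsg1 : ∀ n ω, |sg n ω| ≤ 1 / 2 := fun n ω => abs_div_one_add_sq_le _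
  have hp1 : ∀ n ω, |p n ω| ≤ 1 := fun n ω => by
    have := sq_div_one_add_sq_mem (y n ω)
    rw [abs_of_nonneg this.1]; exact this.2
  have hpy : ∀ n ω, y n ω * sg n ω = p n ω := fun n ω => by simp only [hsg, hp]; ring
  have hWm : ∀ i, AEStronglyMeasurable (W i) μ := fun i => (hsgm _).sub (hsgm _)
  have hW1 : ∀ i ω, |W i ω| ≤ 1 := fun i ω => by
    have := abs_sub (sg i.2 ω) (sg i.1 ω)
    have h1 := hsg1 i.2 ω
    have h2 := hsg1 i.1 ω
    simp only [hW]; linarith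
  have hmulm : ∀ {f g : Ω → ℝ}, Integrable f μ → AEStronglyMeasurable g μ → (∀ ω, |g ω| ≤ 1) →
      Integrable (fun ω => f ω * g ω) μ := fun hf hg hg1 =>
    hf.mul_bdd (c := 1) hg (ae_of_all _ hg1)
  have hmulle : ∀ {f g : Ω → ℝ}, Integrable f μ → AEStronglyMeasurable g μ → (∀ ω, |g ω| ≤ 1) →
      |∫ ω, f ω * g ω ∂μ| ≤ ∫ ω, |f ω| ∂μ := fun {f g} hf hg hg1 => by
    refine abs_integral_le_integral_abs.trans
      (integral_mono (hmulm hf hg hg1).abs hf.abs fun ω => ?_)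
    simp only [abs_mul]
    exact mul_le_of_le_one_right (abs_nonneg _) (hg1 ω)
  have hpint : ∀ n, Integrable (p n) μ := fun n => Integrable.of_bound (hpm n) 1 (ae_of_all _ (hp1 n))
  have hprod1 : ∀ {g h : Ω → ℝ}, (∀ ω, |g ω| ≤ 1) → (∀ ω, |h ω| ≤ 1) → ∀ ω, |g ω * h ω| ≤ 1 :=
    fun hg hh ω => by rw [abs_mul]; exact mul_le_one₀ (hg ω) (abs_nonneg _) (hh ω)
  have hsg1' : ∀ n ω, |sg n ω| ≤ 1 := fun n ω => (hsg1 n ω).trans (by norm_num)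
  -- `Λ` is the limit functional of `y n * sg n = p n`. The integrals of `Y i * W i * g` tend to `Λ
  -- g`, which need not vanish, so smallness of `Λ` on products of test functions has to be arranged
  -- separately.
  set Λ : (Ω → ℝ) → ℝ := fun g => limUnder (U : Filter ℕ) fun n => ∫ ω, p n ω * g ω ∂μ with hΛ
  have hΛt : ∀ g : Ω → ℝ, AEStronglyMeasurable g μ → (∀ ω, |g ω| ≤ 1) →
      Tendsto (fun n => ∫ ω, p n ω * g ω ∂μ) U (𝓝 (Λ g)) := fun g hg hg1 => by
    refine tendsto_nhds_limUnder (U.exists_tendsto_of_abs_le (K := 1) fun n => ?_)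
    refine (hmulle (hpint n) hg hg1).trans ?_
    calc ∫ ω, |p n ω| ∂μ ≤ ∫ _, (1 : ℝ) ∂μ :=
          integral_mono (hpint n).abs (integrable_const 1) (hp1 n)
      _ = 1 := by simp
  have hweakU : ∀ g : Ω → ℝ, AEStronglyMeasurable g μ → (∀ ω, |g ω| ≤ 1) → ∀ ε : ℝ, 0 < ε →
      ∀ᶠ n in (U : Filter ℕ), |∫ ω, y n ω * g ω ∂μ| < ε := fun g hg hg1 ε hε => by
    have h := ((hweak g hg hg1).mono_left hU) (Metric.ball_mem_nhds 0 hε)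
    filter_upwards [h] with n hn
    simpa using hn
  have hY0 : ∀ g : Ω → ℝ, AEStronglyMeasurable g μ → (∀ ω, |g ω| ≤ 1) → ∀ ε : ℝ, 0 < ε →
      ∀ᶠ i in F, |∫ ω, Y i ω * g ω ∂μ| < ε := fun g hg hg1 ε hε =>
    eventually_curry_iff.mpr (Eventually.of_forall fun m => hweakU g hg hg1 ε hε)
  have hW0 : ∀ f : Ω → ℝ, Integrable f μ → ∀ ε : ℝ, 0 < ε →
      ∀ᶠ i in F, |∫ ω, f ω * W i ω ∂μ| < ε := fun f hf ε hε => by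
    obtain ⟨L, hL⟩ := U.exists_tendsto_of_abs_le (b := fun n => ∫ ω, f ω * sg n ω ∂μ)
      fun n => hmulle hf (hsgm n) (hsg1' n)
    filter_upwards [eventually_curry_abs_sub_lt hL hε] with i hi
    rw [← integral_sub (hmulm hf (hsgm _) (hsg1' _)) (hmulm hf (hsgm _) (hsg1' _))] at hi
    simpa only [hW, mul_sub] using hi
  have hYWint : ∀ (i : ℕ × ℕ) (g : Ω → ℝ), AEStronglyMeasurable g μ → (∀ ω, |g ω| ≤ 1) →
      ∫ ω, Y i ω * (W i ω * g ω) ∂μ =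
        ∫ ω, p i.2 ω * g ω ∂μ - ∫ ω, y i.2 ω * (sg i.1 ω * g ω) ∂μ := fun i g hg hg1 => by
    rw [← integral_sub (hmulm (hpint _) hg hg1)
      (hmulm (g := fun ω => sg i.1 ω * g ω) (hy _) ((hsgm _).mul hg) (hprod1 (hsg1' _) hg1))]
    refine integral_congr_ae (ae_of_all _ fun ω => ?_)
    simp only [hY, hW, ← hpy]
    ring
  have hYW : ∀ g : Ω → ℝ, AEStronglyMeasurable g μ → (∀ ω, |g ω| ≤ 1) → ∀ ε : ℝ, 0 < ε →
      ∀ᶠ i in F, |∫ ω, Y i ω * (W i ω * g ω) ∂μ - Λ g| < ε := fun g hg hg1 ε hε => by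
    refine eventually_curry_iff.mpr (Eventually.of_forall fun m => ?_)
    have h1 := (hΛt g hg hg1) (Metric.ball_mem_nhds _ (half_pos hε))
    filter_upwards [h1, hweakU (fun ω => sg m ω * g ω) ((hsgm _).mul hg)
      (hprod1 (hsg1' _) hg1) _ (half_pos hε)] with n h2 h3
    rw [hYWint _ g hg hg1]
    have h4 : |∫ ω, p n ω * g ω ∂μ - Λ g| < ε / 2 := by simpa [Real.dist_eq] using h2
    have h5 := abs_sub (∫ ω, p n ω * g ω ∂μ - Λ g) (∫ ω, y n ω * (sg m ω * g ω) ∂μ)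
    simp only [sub_right_comm _ _ (Λ g)] at h5 ⊢
    linarith
  -- `Λ (W i * g)` is a difference of two values of the bounded sequence `n ↦ Λ (sg n * g)`.
  have hΛW : ∀ g : Ω → ℝ, AEStronglyMeasurable g μ → (∀ ω, |g ω| ≤ 1) → ∀ ε : ℝ, 0 < ε →
      ∀ᶠ i in F, |Λ (fun ω => W i ω * g ω)| < ε := fun g hg hg1 ε hε => by
    have hgood : ∀ n, AEStronglyMeasurable (fun ω => sg n ω * g ω) μ := fun n => (hsgm n).mul hg
    have hgood1 : ∀ n ω, |sg n ω * g ω| ≤ 1 := fun n => hprod1 (hsg1' n) hg1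
    have hbd : ∀ n, |Λ (fun ω => sg n ω * g ω)| ≤ 1 := fun n => by
      refine le_of_tendsto (hΛt _ (hgood n) (hgood1 n)).abs (Eventually.of_forall fun k => ?_)
      refine (hmulle (hpint k) (hgood n) (hgood1 n)).trans ?_
      calc ∫ ω, |p k ω| ∂μ ≤ ∫ _, (1 : ℝ) ∂μ :=
            integral_mono (hpint k).abs (integrable_const 1) (hp1 k)
        _ = 1 := by simp
    obtain ⟨L, hL⟩ := U.exists_tendsto_of_abs_le hbd
    filter_upwards [eventually_curry_abs_sub_lt hL hε] with i hi
    have h1 : Λ (fun ω => W i ω * g ω) =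
        Λ (fun ω => sg i.2 ω * g ω) - Λ (fun ω => sg i.1 ω * g ω) := by
      refine tendsto_nhds_unique (hΛt _ ((hWm i).mul hg) (hprod1 (hW1 i) hg1)) ?_
      refine ((hΛt _ (hgood i.2) (hgood1 i.2)).sub (hΛt _ (hgood i.1) (hgood1 i.1))).congr
        fun n => ?_
      rw [← integral_sub (hmulm (hpint n) (hgood _) (hgood1 _))
        (hmulm (hpint n) (hgood _) (hgood1 _))]
      refine integral_congr_ae (ae_of_all _ fun ω => ?_)
      simp only [hW]
      ring
    rw [h1]; exact hi
  have hdiag : ∀ᶠ i in F, δ / 2 ≤ ∫ ω, Y i ω * W i ω ∂μ := by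
    refine eventually_curry_iff.mpr (Eventually.of_forall fun m => ?_)
    filter_upwards [hδ, hweakU (sg m) (hsgm m) (hsg1' m) _ (half_pos hδ0)] with n h1 h2
    have h3 := hYWint (m, n) (fun _ => 1) aestronglyMeasurable_const (by simp)
    simp only [mul_one] at h3
    rw [h3]
    have := (abs_lt.mp h2).2
    change δ ≤ ∫ ω, p n ω ∂μ at h1
    linarith
  set η : ℝ := δ / 36 with hη
  have hη0 : 0 < η := by positivity
  -- The four bounds for each `S` treat, in order: `Y` newest, `W` newest against an older `Y`, both
  -- newest, and the limit functional. The third relies on the fourth at an earlier stage; it omits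
  -- the empty `S`, which is the diagonal term.
  let Q : ℕ → (ℕ → ℕ × ℕ) → ℕ × ℕ → Prop := fun k f i =>
    (∀ j ∈ Finset.range k, (f j).2 < i.2) ∧ δ / 2 ≤ ∫ ω, Y i ω * W i ω ∂μ ∧
    ∀ S ∈ (Finset.range k).powerset,
      |∫ ω, Y i ω * ∏ l ∈ S, W (f l) ω ∂μ| ≤
        η * ((1 / 4 : ℝ) ^ (k + 1) * ∏ l ∈ S, (1 / 4 : ℝ) ^ (l + 1)) ∧
      (∀ j ∈ Finset.range k, |∫ ω, (Y (f j) ω * ∏ l ∈ S, W (f l) ω) * W i ω ∂μ| ≤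
        η * ((1 / 4 : ℝ) ^ (j + 1) * ((1 / 4 : ℝ) ^ (k + 1) * ∏ l ∈ S, (1 / 4 : ℝ) ^ (l + 1)))) ∧
      (S.Nonempty → |∫ ω, Y i ω * (W i ω * ∏ l ∈ S, W (f l) ω) ∂μ| ≤
        2 * η * ∏ l ∈ S, (1 / 4 : ℝ) ^ (l + 1)) ∧
      |Λ (fun ω => W i ω * ∏ l ∈ S, W (f l) ω)| ≤
        η * ((1 / 4 : ℝ) ^ (k + 1) * ∏ l ∈ S, (1 / 4 : ℝ) ^ (l + 1))
  have hWprodm : ∀ (f : ℕ → ℕ × ℕ) (S : Finset ℕ),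
      AEStronglyMeasurable (fun ω => ∏ l ∈ S, W (f l) ω) μ := fun f S =>
    aestronglyMeasurable_finset_prod (fun l => hWm (f l)) S
  have hWprod1 : ∀ (f : ℕ → ℕ × ℕ) (S : Finset ℕ) ω, |∏ l ∈ S, W (f l) ω| ≤ 1 := fun f S ω => by
    rw [Finset.abs_prod]
    exact Finset.prod_le_one (fun _ _ => abs_nonneg _) fun l _ => hW1 (f l) ω
  obtain ⟨f, hf⟩ := exists_seq_of_forall_step Q (by
    intro k f g i hfg hi
    have hprod : ∀ S ∈ (Finset.range k).powerset, ∀ ω,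
        ∏ l ∈ S, W (f l) ω = ∏ l ∈ S, W (g l) ω := fun S hS ω =>
      Finset.prod_congr rfl fun l hl => by
        rw [hfg l (Finset.mem_range.mp (Finset.mem_powerset.mp hS hl))]
    refine ⟨fun j hj => hfg j (Finset.mem_range.mp hj) ▸ hi.1 j hj, hi.2.1, fun S hS => ?_⟩
    have h := hi.2.2 S hS
    simp only [hprod S hS] at h
    exact ⟨h.1, fun j hj => hfg j (Finset.mem_range.mp hj) ▸ h.2.1 j hj, h.2.2⟩) (by
    intro k f hf
    suffices h : ∀ᶠ i in F, Q k f i by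
      obtain ⟨m, hm⟩ := (eventually_curry_iff.mp h).exists
      obtain ⟨n, hn⟩ := hm.exists
      exact ⟨(m, n), hn⟩
    refine Filter.Eventually.and ?_ (hdiag.and ?_)
    · rw [eventually_all_finset]
      intro j _
      exact eventually_curry_iff.mpr (Eventually.of_forall fun m =>
        (hU (eventually_gt_atTop (f j).2)))
    rw [eventually_all_finset]
    intro S hS
    refine Filter.Eventually.and ?_ (Filter.Eventually.and ?_ (Filter.Eventually.and ?_ ?_))
    · exact (hY0 _ (hWprodm f S) (hWprod1 f S) _ (by positivity)).mono fun _ h => h.le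
    · rw [eventually_all_finset]
      intro j _
      exact (hW0 _ (hmulm (hy (f j).2) (hWprodm f S) (hWprod1 f S)) _
        (by positivity)).mono fun _ h => h.le
    · rcases S.eq_empty_or_nonempty with rfl | hne
      · simp
      -- This was secured when the largest element of `S` was chosen.
      have hΛS : |Λ (fun ω => ∏ l ∈ S, W (f l) ω)| ≤ η * ∏ l ∈ S, (1 / 4 : ℝ) ^ (l + 1) := by
        have hmem := S.max'_mem hne
        have hlt := Finset.mem_range.mp (Finset.mem_powerset.mp hS hmem)
        have hsub : S.erase (S.max' hne) ∈ (Finset.range (S.max' hne)).powerset := by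
          refine Finset.mem_powerset.mpr fun l hl => Finset.mem_range.mpr ?_
          exact lt_of_le_of_ne (S.le_max' l (Finset.mem_of_mem_erase hl))
            (Finset.ne_of_mem_erase hl)
        have h := ((hf _ hlt).2.2 _ hsub).2.2.2
        have e1 := Finset.mul_prod_erase S (fun l => (1 / 4 : ℝ) ^ (l + 1)) hmem
        have e2 := fun ω => Finset.mul_prod_erase S (fun l => W (f l) ω) hmem
        simpa only [e1, e2] using h
      have hpos : 0 < η * ∏ l ∈ S, (1 / 4 : ℝ) ^ (l + 1) := by positivity
      filter_upwards [hYW _ (hWprodm f S) (hWprod1 f S) _ hpos] with i hi _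
      have := abs_sub_abs_le_abs_sub (∫ ω, Y i ω * (W i ω * ∏ l ∈ S, W (f l) ω) ∂μ)
        (Λ fun ω => ∏ l ∈ S, W (f l) ω)
      linarith
    · exact (hΛW _ (hWprodm f S) (hWprod1 f S) _ (by positivity)).mono fun _ h => h.le)
  refine ⟨fun k => (f k).2, strictMono_nat_of_lt_succ fun k =>
    (hf (k + 1)).1 k (Finset.self_mem_range_succ k), fun s a ha => ?_⟩
  have := le_integral_abs_sum (y := fun k => Y (f k)) (w := fun k => W (f k)) (μ := μ)
    (δ := δ / 2) (η := η) (fun i => hy _) (fun i => hWm _) (fun i => hW1 _) hη0.le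
    (by rw [hη]; linarith) (fun j S hjS => ?_) (fun j S hj hle hne => ?_) (fun j => (hf j).2.1) s a ha
  · calc δ / 8 = δ / 2 / 4 := by ring
      _ ≤ _ := this
  · by_cases hlt : ∀ i ∈ S, i < j
    · exact ((hf j).2.2 S (Finset.mem_powerset.mpr fun i hi =>
        Finset.mem_range.mpr (hlt i hi))).1
    · push Not at hlt
      obtain ⟨i, hi, hji⟩ := hlt
      have hne : S.Nonempty := ⟨i, hi⟩
      have hmem := S.max'_mem hne
      have hjm : j < S.max' hne := by
        refine lt_of_le_of_ne (hji.trans (S.le_max' i hi)) fun h => hjS ⟨h ▸ hmem, fun l hl => ?_⟩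
        rw [h]; exact S.le_max' l hl
      have hsub : S.erase (S.max' hne) ∈ (Finset.range (S.max' hne)).powerset := by
        refine Finset.mem_powerset.mpr fun l hl => Finset.mem_range.mpr ?_
        exact lt_of_le_of_ne (S.le_max' l (Finset.mem_of_mem_erase hl))
          (Finset.ne_of_mem_erase hl)
      have h := ((hf _).2.2 _ hsub).2.1 j (Finset.mem_range.mpr hjm)
      have e1 := Finset.mul_prod_erase S (fun l => (1 / 4 : ℝ) ^ (l + 1)) hmem
      have e2 := fun ω => Finset.prod_erase_mul S (fun l => W (f l) ω) hmem
      simpa only [mul_assoc, e1, e2] using h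
  · have hsub : S.erase j ∈ (Finset.range j).powerset := by
      refine Finset.mem_powerset.mpr fun l hl => Finset.mem_range.mpr ?_
      exact lt_of_le_of_ne (hle l (Finset.mem_of_mem_erase hl)) (Finset.ne_of_mem_erase hl)
    have hne' : (S.erase j).Nonempty := by
      rw [Finset.nonempty_iff_ne_empty, Ne, Finset.erase_eq_empty_iff]
      rintro (rfl | h)
      · simp at hj
      · exact hne h
    have h := ((hf j).2.2 _ hsub).2.2.1 hne'
    have e2 := fun ω => Finset.mul_prod_erase S (fun l => W (f l) ω) hj
    simpa only [e2] using h

end LowerEstimate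

/-! ### Upper and lower estimates against the `ℓ₂` basis -/

section TwoEstimates

open Filter Topology

variable {X Y : Type*} [NormedAddCommGroup X] [NormedSpace ℝ X] [NormedAddCommGroup Y]
  [NormedSpace ℝ Y]

/-- `x` dominates `c` times the unit vector basis of `ℓ₂`. -/
def HasLowerTwoEstimateWith (c : ℝ) (x : ℕ → X) : Prop :=
  ∀ (s : Finset ℕ) (a : ℕ → ℝ), c * √(∑ k ∈ s, a k ^ 2) ≤ ‖∑ k ∈ s, a k • x k‖

theorem sum_comp_injective {x : ℕ → X} {φ : ℕ → ℕ} (hφ : Function.Injective φ) (s : Finset ℕ)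
    (a : ℕ → ℝ) :
    ∑ k ∈ s.map ⟨φ, hφ⟩, Function.extend φ a 0 k ^ 2 = ∑ k ∈ s, a k ^ 2 ∧
      ∑ k ∈ s.map ⟨φ, hφ⟩, Function.extend φ a 0 k • x k = ∑ k ∈ s, a k • x (φ k) := by
  constructor <;> simp [Finset.sum_map, hφ.extend_apply]

theorem HasUpperTwoEstimate.comp_injective {x : ℕ → X} (hx : HasUpperTwoEstimate x) {φ : ℕ → ℕ}
    (hφ : Function.Injective φ) : HasUpperTwoEstimate fun k => x (φ k) := by
  obtain ⟨C, hC, h⟩ := hx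
  refine ⟨C, hC, fun s a => ?_⟩
  have h1 := sum_comp_injective (x := x) hφ s a
  rw [← h1.1, ← h1.2]
  exact h _ _

theorem HasLowerTwoEstimateWith.comp_injective {c : ℝ} {x : ℕ → X}
    (hx : HasLowerTwoEstimateWith c x) {φ : ℕ → ℕ} (hφ : Function.Injective φ) :
    HasLowerTwoEstimateWith c fun k => x (φ k) := by
  intro s a
  have h1 := sum_comp_injective (x := x) hφ s a
  rw [← h1.1, ← h1.2]
  exact hx _ _

theorem IsEquivalentToLpBasis.exists_two_estimates {x : ℕ → X} (hx : IsEquivalentToLpBasis 2 x) :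
    HasUpperTwoEstimate x ∧ ∃ c : ℝ, 0 < c ∧ HasLowerTwoEstimateWith c x := by
  obtain ⟨C, hC, h⟩ := hx
  have key : ∀ (s : Finset ℕ) (a : ℕ → ℝ),
      C⁻¹ * √(∑ k ∈ s, a k ^ 2) ≤ ‖∑ k ∈ s, a k • x k‖ ∧
        ‖∑ k ∈ s, a k • x k‖ ≤ C * √(∑ k ∈ s, a k ^ 2) := by
    intro s a
    have hsub : s ⊆ Finset.range (s.sup id + 1) := fun k hk =>
      Finset.mem_range.mpr (Nat.lt_succ_of_le (Finset.le_sup (f := id) hk))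
    have h1 := h (s.sup id + 1) fun k => if k ∈ s then a k else 0
    have h2 : ∑ k ∈ Finset.range (s.sup id + 1), (if k ∈ s then a k else 0) • x k =
        ∑ k ∈ s, a k • x k := by
      rw [← Finset.sum_subset hsub fun k _ hk => by simp [hk]]
      exact Finset.sum_congr rfl fun k hk => by simp [hk]
    have h3 : ∑ k ∈ Finset.range (s.sup id + 1), |if k ∈ s then a k else 0| ^ (2 : ℝ) =
        ∑ k ∈ s, a k ^ 2 := by
      rw [← Finset.sum_subset hsub fun k _ hk => by simp [hk]]
      exact Finset.sum_congr rfl fun k hk => by simp [hk]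
    rw [h2, h3, ← Real.sqrt_eq_rpow] at h1
    exact h1
  exact ⟨⟨C, hC, fun s a => (key s a).2⟩, C⁻¹, inv_pos.mpr hC, fun s a => (key s a).1⟩

theorem hasLowerTwoEstimateWith_of_normalized {c : ℝ} {x : ℕ → X}
    (h : ∀ (s : Finset ℕ) (a : ℕ → ℝ), ∑ k ∈ s, a k ^ 2 = 1 → c ≤ ‖∑ k ∈ s, a k • x k‖) :
    HasLowerTwoEstimateWith c x := by
  intro s a
  rcases (Real.sqrt_nonneg (∑ k ∈ s, a k ^ 2)).eq_or_lt with h0 | hpos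
  · rw [← h0, mul_zero]; exact norm_nonneg _
  set A := √(∑ k ∈ s, a k ^ 2) with hA
  have hA2 : A ^ 2 = ∑ k ∈ s, a k ^ 2 := Real.sq_sqrt (Finset.sum_nonneg fun i _ => sq_nonneg _)
  have h1 := h s (fun k => A⁻¹ * a k) (by
    simp only [mul_pow]
    rw [← Finset.mul_sum, ← hA2]
    field_simp)
  have h2 : ∑ k ∈ s, (A⁻¹ * a k) • x k = A⁻¹ • ∑ k ∈ s, a k • x k := by
    simp only [Finset.smul_sum, smul_smul]
  rw [h2, norm_smul, Real.norm_of_nonneg (inv_pos.mpr hpos).le] at h1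
  rw [mul_comm]
  calc A * c ≤ A * (A⁻¹ * ‖∑ k ∈ s, a k • x k‖) := by gcongr
    _ = _ := by rw [← mul_assoc, mul_inv_cancel₀ hpos.ne', one_mul]

theorem abs_le_sqrt_sum_sq {s : Finset ℕ} (a : ℕ → ℝ) {k : ℕ} (hk : k ∈ s) :
    |a k| ≤ √(∑ k ∈ s, a k ^ 2) := by
  rw [← Real.sqrt_sq_eq_abs]
  exact Real.sqrt_le_sqrt (Finset.single_le_sum (f := fun i => a i ^ 2)
    (fun i _ => sq_nonneg _) hk)

/-- Lower estimates are stable under small perturbations. -/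
theorem HasLowerTwoEstimateWith.perturb {c : ℝ} {x z : ℕ → X} (hx : HasLowerTwoEstimateWith c x)
    {η : ℝ} (hη : 0 ≤ η) (hxz : ∀ k, ‖z k - x k‖ ≤ η * (1 / 2) ^ k) :
    HasLowerTwoEstimateWith (c - 2 * η) z := by
  intro s a
  set A := √(∑ k ∈ s, a k ^ 2) with hA
  have hA0 : 0 ≤ A := Real.sqrt_nonneg _
  -- Each coefficient is at most the `ℓ₂` norm, and the geometric series sums to `2`.
  have h1 : ‖∑ k ∈ s, a k • (z k - x k)‖ ≤ 2 * η * A := by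
    calc ‖∑ k ∈ s, a k • (z k - x k)‖ ≤ ∑ k ∈ s, A * (η * (1 / 2) ^ k) := by
          refine norm_sum_le_of_le _ fun k hk => ?_
          rw [norm_smul, Real.norm_eq_abs]
          exact mul_le_mul (abs_le_sqrt_sum_sq a hk) (hxz k) (norm_nonneg _) hA0
      _ = A * η * ∑ k ∈ s, (1 / 2 : ℝ) ^ k := by
          rw [Finset.mul_sum]; simp only [mul_assoc]
      _ ≤ A * η * 2 := mul_le_mul_of_nonneg_left
          (sum_le_hasSum s (fun _ _ => by positivity) hasSum_geometric_two) (by positivity)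
      _ = _ := by ring
  have h2 : ∑ k ∈ s, a k • z k = ∑ k ∈ s, a k • x k + ∑ k ∈ s, a k • (z k - x k) := by
    rw [← Finset.sum_add_distrib]
    exact Finset.sum_congr rfl fun k _ => by rw [← smul_add, add_sub_cancel]
  have h3 := norm_sub_le_norm_add (∑ k ∈ s, a k • x k) (∑ k ∈ s, a k • (z k - x k))
  rw [← h2] at h3
  have := hx s a
  linarith

theorem HasUpperTwoEstimate.smul {x : ℕ → X} (hx : HasUpperTwoEstimate x) (t : ℝ) :
    HasUpperTwoEstimate fun k => t • x k := by
  obtain ⟨C, hC, h⟩ := hx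
  refine ⟨(|t| + 1) * C, by positivity, fun s a => ?_⟩
  have h1 : ∑ k ∈ s, a k • t • x k = t • ∑ k ∈ s, a k • x k := by
    rw [Finset.smul_sum]
    exact Finset.sum_congr rfl fun k _ => smul_comm _ _ _
  rw [h1, norm_smul, Real.norm_eq_abs, mul_assoc]
  exact mul_le_mul (by linarith) (h s a) (norm_nonneg _) (by positivity)

theorem HasUpperTwoEstimate.exists_norm_le {x : ℕ → X} (hx : HasUpperTwoEstimate x) :
    ∃ C : ℝ, 0 < C ∧ ∀ k, ‖x k‖ ≤ C := by
  obtain ⟨C, hC, h⟩ := hx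
  exact ⟨C, hC, fun k => by simpa using h {k} fun _ => 1⟩

/-- A sequence with an upper `2`-estimate is weakly null. -/
theorem HasUpperTwoEstimate.tendsto_zero {x : ℕ → X} (hx : HasUpperTwoEstimate x)
    (f : X →L[ℝ] ℝ) : Tendsto (fun n => f (x n)) atTop (𝓝 0) := by
  obtain ⟨C, hC, h⟩ := hx
  -- Testing the upper estimate with coefficients `f (x k)` shows that these values are square
  -- summable.
  have hsum : Summable fun n => f (x n) ^ 2 := by
    refine summable_of_sum_le (c := (‖f‖ * C) ^ 2) (fun n => sq_nonneg _) fun s => ?_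
    set A := √(∑ k ∈ s, f (x k) ^ 2) with hA
    have hA0 : 0 ≤ A := Real.sqrt_nonneg _
    have hA2 : A ^ 2 = ∑ k ∈ s, f (x k) ^ 2 :=
      Real.sq_sqrt (Finset.sum_nonneg fun i _ => sq_nonneg _)
    have h1 : ∑ k ∈ s, f (x k) ^ 2 ≤ ‖f‖ * (C * A) := by
      calc ∑ k ∈ s, f (x k) ^ 2 = f (∑ k ∈ s, f (x k) • x k) := by
            simp [map_sum, sq]
        _ ≤ ‖f (∑ k ∈ s, f (x k) • x k)‖ := le_abs_self _
        _ ≤ ‖f‖ * ‖∑ k ∈ s, f (x k) • x k‖ := f.le_opNorm _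
        _ ≤ ‖f‖ * (C * A) := mul_le_mul_of_nonneg_left (h s fun k => f (x k)) (norm_nonneg _)
    rw [← hA2] at h1 ⊢
    rcases hA0.eq_or_lt with h0 | hpos
    · rw [← h0, zero_pow two_ne_zero]; positivity
    · have : A ≤ ‖f‖ * C := le_of_mul_le_mul_right (by linarith [sq A]) hpos
      exact pow_le_pow_left₀ hA0 this 2
  have h2 := hsum.tendsto_atTop_zero.sqrt
  simp only [Real.sqrt_sq_eq_abs, Real.sqrt_zero] at h2
  exact (tendsto_zero_iff_abs_tendsto_zero _).mpr h2

/-- An operator mapping a sequence with an upper `2`-estimate to a sequence with a lower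
`2`-estimate is an isomorphism on its span. -/
theorem not_isStrictlySingular_of_two_estimates (T : X →L[ℝ] Y) {x : ℕ → X}
    (hx : HasUpperTwoEstimate x) {c : ℝ} (hc : 0 < c)
    (hTx : HasLowerTwoEstimateWith c fun k => T (x k)) : ¬ IsStrictlySingular T := by
  intro hT
  obtain ⟨C, hC, h⟩ := hx
  have hmap : ∀ (s : Finset ℕ) (a : ℕ → ℝ),
      T (∑ k ∈ s, a k • x k) = ∑ k ∈ s, a k • T (x k) := fun s a => by simp [map_sum]
  have hli : LinearIndependent ℝ x := by
    rw [linearIndependent_iff']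
    intro s a ha i hi
    have h1 := hTx s a
    rw [← hmap, ha, map_zero, norm_zero] at h1
    have h2 := abs_le_sqrt_sum_sq a hi
    have h3 : √(∑ k ∈ s, a k ^ 2) ≤ 0 := by
      by_contra! hpos
      linarith [mul_pos hc hpos]
    exact abs_nonpos_iff.mp (h2.trans h3)
  refine hT (Submodule.span ℝ (Set.range x)) (fun hfin => ?_) ⟨c / C, by positivity, fun z hz => ?_⟩
  · have := Module.Finite.finite_basis (Module.Basis.span hli)
    exact not_finite ℕ
  · obtain ⟨a, rfl⟩ := (Finsupp.mem_span_range_iff_exists_finsupp).mp hz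
    rw [Finsupp.sum, hmap]
    refine le_trans ?_ (hTx _ _)
    have := h a.support a
    rw [div_mul_eq_mul_div, div_le_iff₀ hC]
    calc c * ‖∑ k ∈ a.support, a k • x k‖ ≤ c * (C * √(∑ k ∈ a.support, a k ^ 2)) := by gcongr
      _ = _ := by ring

end TwoEstimates

/-! ### The dichotomy for images of upper `ℓ₂` sequences -/

section DisjointlyHomogeneous

open Filter Topology

variable {E : Type*} [NormedAddCommGroup E] [Lattice E] [IsOrderedAddMonoid E]
  [NormedSpace ℝ E] [IsOrderedModule ℝ E]

/-- In a `2`-disjointly homogeneous lattice, a sequence bounded away from `0` that is close to a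
disjoint one has a subsequence with a lower `2`-estimate. -/
theorem IsDisjointlyHomogeneous.exists_subseq_lower_of_near_disjoint
    (hDH : IsDisjointlyHomogeneous 2 E) {y d : ℕ → E} {δ : ℝ} (hδ : 0 < δ) (hy : ∀ k, δ ≤ ‖y k‖)
    (hd : ∀ m n, m ≠ n → |d m| ⊓ |d n| = 0) (hyd : ∀ k, ‖y k - d k‖ ≤ 6 * (1 / 2) ^ k) :
    ∃ φ : ℕ → ℕ, StrictMono φ ∧ ∃ c : ℝ, 0 < c ∧ HasLowerTwoEstimateWith c fun k => y (φ k) := by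
  have hpow : ∀ ε : ℝ, 0 < ε → ∃ K : ℕ, 6 * (1 / 2 : ℝ) ^ K ≤ ε := fun ε hε => by
    obtain ⟨K, hK⟩ := exists_pow_lt_of_lt_one (by positivity : 0 < ε / 6)
      (by norm_num : (1 / 2 : ℝ) < 1)
    exact ⟨K, by linarith⟩
  -- Dropping `K` terms keeps the disjoint sequence away from `0`, so it can be normalized.
  obtain ⟨K, hK⟩ := hpow (δ / 2) (by positivity)
  have hdn : ∀ k, δ / 2 ≤ ‖d (k + K)‖ := fun k => by
    have h1 := hyd (k + K)
    have h2 : (1 / 2 : ℝ) ^ (k + K) ≤ (1 / 2) ^ K :=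
      pow_le_pow_of_le_one (by norm_num) (by norm_num) (Nat.le_add_left _ _)
    have h3 := norm_sub_norm_le (y (k + K)) (d (k + K))
    have h4 := hy (k + K)
    linarith
  have hdpos : ∀ k, 0 < ‖d (k + K)‖ := fun k => (half_pos hδ).trans_le (hdn k)
  set z : ℕ → E := fun k => ‖d (k + K)‖⁻¹ • d (k + K) with hz
  have hzn : IsNormalizedDisjoint z := by
    refine ⟨fun k => ?_, fun m n hmn => ?_⟩
    · rw [hz, norm_smul, norm_inv, norm_norm, inv_mul_cancel₀ (hdpos k).ne']
    · have habs : ∀ k, |z k| ≤ ‖d (k + K)‖⁻¹ • |d (k + K)| := fun k => by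
        refine abs_le'.mpr ⟨smul_le_smul_of_nonneg_left (le_abs_self _) (by positivity), ?_⟩
        rw [hz, ← smul_neg]
        exact smul_le_smul_of_nonneg_left (neg_le_abs _) (by positivity)
      have h1 := smul_inf_eq_zero (c := ‖d (m + K)‖⁻¹) (by positivity) (abs_nonneg (d (m + K)))
        (abs_nonneg (d (n + K))) (hd _ _ (by omega))
      rw [inf_comm] at h1
      have h2 := smul_inf_eq_zero (c := ‖d (n + K)‖⁻¹) (by positivity) (abs_nonneg (d (n + K)))
        (smul_nonneg (by positivity) (abs_nonneg _)) h1
      rw [inf_comm] at h2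
      exact le_antisymm ((inf_le_inf (habs m) (habs n)).trans h2.le)
        (le_inf (abs_nonneg _) (abs_nonneg _))
  obtain ⟨ψ, hψ, heq⟩ := hDH z hzn
  obtain ⟨-, c, hc, hlow⟩ := heq.exists_two_estimates
  have hdlow : HasLowerTwoEstimateWith (c * (δ / 2)) fun k => d (ψ k + K) := by
    intro s a
    have h1 := hlow s fun k => a k * ‖d (ψ k + K)‖
    have h2 : ∑ k ∈ s, (a k * ‖d (ψ k + K)‖) • (z ∘ ψ) k = ∑ k ∈ s, a k • d (ψ k + K) :=
      Finset.sum_congr rfl fun k _ => by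
        rw [Function.comp, hz, smul_smul, mul_assoc, mul_inv_cancel₀ (hdpos _).ne', mul_one]
    rw [h2] at h1
    refine le_trans ?_ h1
    rw [mul_assoc]
    refine mul_le_mul_of_nonneg_left ?_ hc.le
    rw [← Real.sqrt_sq (half_pos hδ).le, ← Real.sqrt_mul (sq_nonneg _), Finset.mul_sum]
    refine Real.sqrt_le_sqrt (Finset.sum_le_sum fun k _ => ?_)
    rw [mul_pow, mul_comm]
    exact mul_le_mul_of_nonneg_left (pow_le_pow_left₀ (half_pos hδ).le (hdn _) 2) (sq_nonneg _)
  -- A second shift makes the perturbation cost only half of the lower constant.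
  obtain ⟨K', hK'⟩ := hpow (c * (δ / 2) / 4) (by positivity)
  have hshift : StrictMono fun k : ℕ => k + K' := fun m n h => by simpa using h
  refine ⟨fun k => ψ (k + K') + K, fun m n h => ?_, c * (δ / 2) - 2 * (c * (δ / 2) / 4), ?_, ?_⟩
  · exact Nat.add_lt_add_right (hψ (hshift h)) K
  · have : 0 < c * (δ / 2) := by positivity
    linarith
  · refine (hdlow.comp_injective hshift.injective).perturb (by positivity) fun k => ?_
    refine (hyd _).trans ?_
    have h1 : (1 / 2 : ℝ) ^ (ψ (k + K') + K) ≤ (1 / 2) ^ (K' + k) :=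
      pow_le_pow_of_le_one (by norm_num) (by norm_num) (by
        have := hψ.id_le (k + K')
        simp only [id] at this
        omega)
    calc 6 * (1 / 2 : ℝ) ^ (ψ (k + K') + K) ≤ 6 * (1 / 2) ^ K' * (1 / 2) ^ k := by
          rw [mul_assoc, ← pow_add]; gcongr
      _ ≤ c * (δ / 2) / 4 * (1 / 2) ^ k := by gcongr

/-- Moments of functions truncated at `M` are controlled by `t ^ 2 / (1 + t ^ 2)`, whose integral
measures convergence in measure. -/
theorem min_pow_le_mul_sq_div {r : ℕ} (hr : 2 ≤ r) {t M : ℝ} (ht : 0 ≤ t) (hM : 0 ≤ M) :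
    min t M ^ r ≤ M ^ (r - 2) * (1 + M ^ 2) * (t ^ 2 / (1 + t ^ 2)) := by
  have h0 : 0 ≤ min t M := le_min ht hM
  have h1 : min t M ^ 2 ≤ (1 + M ^ 2) * (t ^ 2 / (1 + t ^ 2)) := by
    rw [mul_div_assoc', le_div_iff₀ (by positivity)]
    rcases le_total t M with h | h
    · rw [min_eq_left h]
      nlinarith [mul_le_mul h h ht hM, sq_nonneg t]
    · rw [min_eq_right h]
      nlinarith [mul_le_mul h h hM ht, sq_nonneg M]
  calc min t M ^ r = min t M ^ (r - 2) * min t M ^ 2 := by rw [← pow_add]; congr 1; omega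
    _ ≤ M ^ (r - 2) * ((1 + M ^ 2) * (t ^ 2 / (1 + t ^ 2))) :=
        mul_le_mul (pow_le_pow_left₀ h0 (min_le_right _ _) _) h1 (sq_nonneg _) (by positivity)
    _ = _ := by ring

variable [HasSolidNorm E] [CompleteSpace E] {Ω : Type*} [MeasurableSpace Ω] {μ : Measure Ω}
  [IsProbabilityMeasure μ] {q : ℝ≥0∞} {J : E →L[ℝ] Lp ℝ 1 μ}

/-- Sequences converging to `0` in measure have small meets with each fixed positive element. -/
theorem IsLatticeEmbeddingAbove.exists_norm_abs_inf_lt (hE : IsOrderContinuousNorm E)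
    (hq : 1 ≤ q) (hq' : q ≠ ∞) (hJ : IsLatticeEmbeddingAbove q J) {u : E} (hu : 0 ≤ u)
    {ε : ℝ} (hε : 0 < ε) :
    ∃ η : ℝ, 0 < η ∧ ∀ y : E, ∫ ω, J y ω ^ 2 / (1 + J y ω ^ 2) ∂μ < η → ‖|y| ⊓ u‖ < ε := by
  obtain ⟨e, he0, he⟩ := hJ.exists_coeFn_eq_one
  obtain ⟨M, hM⟩ := hJ.exists_norm_posPart_sub_smul_lt hE he0 he u (half_pos hε)
  obtain ⟨r, C, hr, hC, hK⟩ := hJ.exists_norm_le_integral_pow hq hq'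
  -- Chosen so that `C * K ^ (1 / r) = ε / 2`.
  set K : ℝ := (ε / (2 * C)) ^ r with hKdef
  have hKpos : 0 < K := by positivity
  set D : ℝ := (M : ℝ) ^ (r - 2) * (1 + (M : ℝ) ^ 2) with hD
  have hD0 : 0 ≤ D := by positivity
  refine ⟨K / (D + 1), by positivity, fun y hy => ?_⟩
  have hJm : AEStronglyMeasurable (J y) μ := Lp.aestronglyMeasurable _
  have hpm : AEStronglyMeasurable (fun ω => J y ω ^ 2 / (1 + J y ω ^ 2)) μ :=
    ((hJm.aemeasurable.pow_const 2).div
      ((hJm.aemeasurable.pow_const 2).const_add 1)).aestronglyMeasurable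
  have hpint : Integrable (fun ω => J y ω ^ 2 / (1 + J y ω ^ 2)) μ :=
    Integrable.of_bound hpm 1 (ae_of_all _ fun ω => by
      have := sq_div_one_add_sq_mem (J y ω)
      rw [Real.norm_of_nonneg this.1]; exact this.2)
  have hpt : ∀ᵐ ω ∂μ, |J (|y| ⊓ (M : ℝ) • e) ω| ^ r ≤ D * (J y ω ^ 2 / (1 + J y ω ^ 2)) := by
    filter_upwards [hJ.coeFn_inf |y| ((M : ℝ) • e), hJ.coeFn_abs y, coeFn_smul J M e, he]
      with ω h1 h2 h3 h4
    rw [h1, h2, h3, h4, mul_one, abs_of_nonneg (le_min (abs_nonneg _) (Nat.cast_nonneg M))]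
    have := min_pow_le_mul_sq_div hr (abs_nonneg (J y ω)) (Nat.cast_nonneg M)
    rwa [sq_abs] at this
  have hint : Integrable (fun ω => |J (|y| ⊓ (M : ℝ) • e) ω| ^ r) μ := by
    refine (hpint.const_mul D).mono' ?_ ?_
    · exact ((Lp.aestronglyMeasurable _).aemeasurable.abs.pow_const r).aestronglyMeasurable
    · filter_upwards [hpt] with ω h
      rwa [Real.norm_of_nonneg (by positivity)]
  have h1 : ∫ ω, |J (|y| ⊓ (M : ℝ) • e) ω| ^ r ∂μ ≤ K := by
    refine (integral_mono_ae hint (hpint.const_mul D) hpt).trans ?_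
    rw [integral_const_mul]
    rw [lt_div_iff₀ (by positivity)] at hy
    have h0 : 0 ≤ ∫ ω, J y ω ^ 2 / (1 + J y ω ^ 2) ∂μ := integral_nonneg fun ω => by positivity
    linarith
  have h2 := hK _ K hint h1
  have h3 : C * K ^ (1 / (r : ℝ)) = ε / 2 := by
    rw [hKdef, one_div, Real.pow_rpow_inv_natCast (by positivity) (by omega)]
    field_simp
  rw [h3] at h2
  have h4 : |y| ⊓ u ≤ |y| ⊓ ((M : ℝ) • e) + (u - (M : ℝ) • e)⁺ := by
    rw [← sub_le_iff_le_add]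
    refine le_inf ((sub_le_self _ (posPart_nonneg _)).trans inf_le_left) ?_
    rw [sub_le_comm]
    exact (sub_le_sub_right inf_le_right _).trans (le_posPart _)
  calc ‖|y| ⊓ u‖ ≤ ‖|y| ⊓ ((M : ℝ) • e) + (u - (M : ℝ) • e)⁺‖ :=
        norm_le_norm_of_nonneg_of_le (le_inf (abs_nonneg _) hu) h4
    _ ≤ ‖|y| ⊓ ((M : ℝ) • e)‖ + ‖(u - (M : ℝ) • e)⁺‖ := norm_add_le _ _
    _ < ε := by linarith

/-- Integration against a bounded function, as a functional on `L₁`. -/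
noncomputable def integralMulCLM (g : Ω → ℝ) (hg : AEStronglyMeasurable g μ)
    (hg1 : ∀ ω, |g ω| ≤ 1) : Lp ℝ 1 μ →L[ℝ] ℝ :=
  LinearMap.mkContinuous
    { toFun := fun f => ∫ ω, f ω * g ω ∂μ
      map_add' := fun f₁ f₂ => by
        rw [← integral_add ((L1.integrable_coeFn f₁).mul_bdd (c := 1) hg (ae_of_all _ hg1))
          ((L1.integrable_coeFn f₂).mul_bdd (c := 1) hg (ae_of_all _ hg1))]
        refine integral_congr_ae ?_
        filter_upwards [Lp.coeFn_add f₁ f₂] with ω h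
        rw [h, Pi.add_apply, add_mul]
      map_smul' := fun c f => by
        rw [RingHom.id_apply, smul_eq_mul, ← integral_const_mul]
        refine integral_congr_ae ?_
        filter_upwards [Lp.coeFn_smul c f] with ω h
        rw [h, Pi.smul_apply, smul_eq_mul, mul_assoc] }
    1 fun f => by
      simp only [LinearMap.coe_mk, AddHom.coe_mk]
      rw [one_mul, L1.norm_eq_integral_norm]
      refine (norm_integral_le_integral_norm _).trans (integral_mono_of_nonneg
        (ae_of_all _ fun _ => norm_nonneg _) (L1.integrable_coeFn f).norm
        (ae_of_all _ fun ω => ?_))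
      simp only [norm_mul]
      exact mul_le_of_le_one_right (norm_nonneg _) (hg1 ω)

/-- A normalized sequence with an upper `2`-estimate, whose image under `T` is bounded away from
zero, contradicts strict singularity of `T`. -/
theorem IsLatticeEmbeddingAbove.not_isStrictlySingular_of_norm_le_one
    (hDH : IsDisjointlyHomogeneous 2 E) (hE : IsOrderContinuousNorm E) (hq : 1 ≤ q) (hq' : q ≠ ∞)
    (hJ : IsLatticeEmbeddingAbove q J) (T : E →L[ℝ] E) {x : ℕ → E} (hx : HasUpperTwoEstimate x)
    {δ : ℝ} (hδ : 0 < δ) (hTx : ∀ k, δ ≤ ‖T (x k)‖) (hTx1 : ∀ k, ‖T (x k)‖ ≤ 1) :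
    ¬ IsStrictlySingular T := by
  suffices h : ∃ φ : ℕ → ℕ, Function.Injective φ ∧ ∃ c : ℝ, 0 < c ∧
      HasLowerTwoEstimateWith c fun k => T (x (φ k)) by
    obtain ⟨φ, hφ, c, hc, hlow⟩ := h
    exact not_isStrictlySingular_of_two_estimates T (hx.comp_injective hφ) hc hlow
  set U : Ultrafilter ℕ := hyperfilter ℕ with hU
  have hUle : (U : Filter ℕ) ≤ atTop := Nat.hyperfilter_le_atTop
  -- Either the images stay away from `0` in measure along `U`, or they come arbitrarily close to
  -- `0` in measure infinitely often.
  by_cases hcase : ∃ η : ℝ, 0 < η ∧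
      ∀ᶠ n in (U : Filter ℕ), η ≤ ∫ ω, J (T (x n)) ω ^ 2 / (1 + J (T (x n)) ω ^ 2) ∂μ
  · obtain ⟨η, hη, hev⟩ := hcase
    obtain ⟨φ, hφ, hlow⟩ := exists_subseq_le_integral_abs_sum (y := fun n => J (T (x n)))
      (fun n => L1.integrable_coeFn _)
      (fun g hg hg1 => hx.tendsto_zero ((integralMulCLM g hg hg1).comp (J.comp T))) U hUle hη hev
    refine ⟨φ, hφ.injective, η / 8 / (‖J‖ + 1), by positivity,
      hasLowerTwoEstimateWith_of_normalized fun s a ha => ?_⟩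
    have h1 := hlow s a ha
    have h2 : ∫ ω, |∑ j ∈ s, a j * J (T (x (φ j))) ω| ∂μ = ‖J (∑ k ∈ s, a k • T (x (φ k)))‖ := by
      rw [L1.norm_eq_integral_norm]
      refine integral_congr_ae ?_
      filter_upwards [coeFn_sum_smul J s a fun k => T (x (φ k))] with ω h
      rw [h, Real.norm_eq_abs]
    rw [h2] at h1
    rw [div_le_iff₀ (by positivity), mul_comm]
    refine h1.trans ((J.le_opNorm _).trans ?_)
    gcongr
    linarith
  · push Not at hcase
    obtain ⟨φ, d, hφ, hd, hyd⟩ := exists_subseq_near_disjoint (fun n => T (x n)) hTx1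
      (fun u hu ε hε N => by
        obtain ⟨η, hη, h⟩ := hJ.exists_norm_abs_inf_lt hE hq hq' hu hε
        obtain ⟨n, hn, hnN⟩ := ((hcase η hη).and (hUle (eventually_ge_atTop N))).exists
        exact ⟨n, hnN, h _ hn⟩)
    obtain ⟨ψ, hψ, c, hc, hlow⟩ := hDH.exists_subseq_lower_of_near_disjoint hδ
      (fun k => hTx (φ k)) hd hyd
    exact ⟨φ ∘ ψ, (hφ.comp hψ).injective, c, hc, hlow⟩

/-- Upper `ℓ₂` sequences are bounded, so scaling puts the images in the unit ball. -/
theorem IsLatticeEmbeddingAbove.not_isStrictlySingular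
    (hDH : IsDisjointlyHomogeneous 2 E) (hE : IsOrderContinuousNorm E) (hq : 1 ≤ q) (hq' : q ≠ ∞)
    (hJ : IsLatticeEmbeddingAbove q J) (T : E →L[ℝ] E) {x : ℕ → E} (hx : HasUpperTwoEstimate x)
    {δ : ℝ} (hδ : 0 < δ) (hTx : ∀ k, δ ≤ ‖T (x k)‖) : ¬ IsStrictlySingular T := by
  obtain ⟨C, hC, hxC⟩ := hx.exists_norm_le
  set t : ℝ := ((‖T‖ + 1) * C)⁻¹ with ht
  have ht0 : 0 < t := by positivity
  refine hJ.not_isStrictlySingular_of_norm_le_one hDH hE hq hq' T (hx.smul t)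
    (mul_pos ht0 hδ) (fun k => ?_) (fun k => ?_)
  · rw [map_smul, norm_smul, Real.norm_of_nonneg ht0.le]
    exact mul_le_mul_of_nonneg_left (hTx k) ht0.le
  · rw [map_smul, norm_smul, Real.norm_of_nonneg ht0.le, ht, inv_mul_le_iff₀ (by positivity),
      mul_one]
    refine (T.le_opNorm _).trans (mul_le_mul (by linarith) (hxC k) (norm_nonneg _) (by positivity))

end DisjointlyHomogeneous

/-! ### Strict singularity and compactness -/

section Compactness

open Filter Topology

theorem exists_seq_of_not_totallyBounded {X Y : Type*} [NormedAddCommGroup Y] {A : Set X} (T : X → Y)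
    (hA : ¬ TotallyBounded (T '' A)) :
    ∃ ε : ℝ, 0 < ε ∧ ∃ u : ℕ → X, (∀ n, u n ∈ A) ∧ ∀ m n, m < n → ε ≤ ‖T (u n) - T (u m)‖ := by
  rw [Metric.totallyBounded_iff] at hA
  push Not at hA
  obtain ⟨ε, hε, h⟩ := hA
  have : Nonempty X := by
    obtain ⟨_, ⟨x, -, -⟩, -⟩ := Set.not_subset.mp (h ∅ Set.finite_empty)
    exact ⟨x⟩
  obtain ⟨u, hu⟩ := exists_seq_of_forall_step
    (Q := fun k (f : ℕ → X) (i : X) => i ∈ A ∧ ∀ j < k, ε ≤ ‖T i - T (f j)‖)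
    (fun k f g i hfg hi => ⟨hi.1, fun j hj => hfg j hj ▸ hi.2 j hj⟩)
    (fun k f _ => by
      obtain ⟨_, ⟨x, hx, rfl⟩, hxn⟩ := Set.not_subset.mp
        (h ((fun j => T (f j)) '' (Finset.range k : Set ℕ)) ((Finset.finite_toSet _).image _))
      refine ⟨x, hx, fun j hj => ?_⟩
      by_contra! hlt
      refine hxn (Set.mem_biUnion ⟨j, by simpa using hj, rfl⟩ ?_)
      rwa [Metric.mem_ball, dist_eq_norm])
  exact ⟨ε, hε, u, fun n => (hu n).1, fun m n hmn => (hu n).2 m hmn⟩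

variable {X Y : Type*} [NormedAddCommGroup X] [NormedSpace ℝ X] [NormedAddCommGroup Y]
  [NormedSpace ℝ Y]

/-- Riesz's lemma gives a bounded `1`-separated sequence in the subspace; boundedness below keeps
its image `c`-separated, with no convergent subsequence. -/
theorem IsCompactOperator.isStrictlySingular {T : X →L[ℝ] Y} (hT : IsCompactOperator T) :
    IsStrictlySingular T := by
  rintro M hM ⟨c, hc, h⟩
  obtain ⟨R, f, -, hfR, hf⟩ := exists_seq_norm_le_one_le_norm_sub (𝕜 := ℝ) (E := M) hM
  have hcpt := hT.isCompact_closure_image_closedBall R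
  obtain ⟨z, -, φ, hφ, hz⟩ := hcpt.tendsto_subseq (x := fun n => T (f n)) fun n =>
    subset_closure ⟨f n, by simpa using hfR n, rfl⟩
  obtain ⟨N, hN⟩ := Metric.cauchySeq_iff.mp hz.cauchySeq c hc
  have h1 := hN N le_rfl (N + 1) (Nat.le_succ N)
  have h2 := hf (hφ (Nat.lt_succ_self N)).ne
  have h3 := h (f (φ N) - f (φ (N + 1)) : M) (Submodule.coe_mem _)
  simp only [Function.comp, dist_eq_norm, ← map_sub] at h1
  rw [Submodule.coe_sub] at h3
  have h4 : ‖(f (φ N) : X) - f (φ (N + 1))‖ = ‖f (φ N) - f (φ (N + 1))‖ := by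
    rw [← Submodule.coe_sub, Submodule.coe_norm]
  rw [h4] at h3
  nlinarith

variable {E : Type*} [NormedAddCommGroup E] [Lattice E] [IsOrderedAddMonoid E] [HasSolidNorm E]
  [NormedSpace ℝ E] [IsOrderedModule ℝ E] [CompleteSpace E]
  {Ω : Type*} [MeasurableSpace Ω] {μ : Measure Ω} [IsProbabilityMeasure μ] {q : ℝ≥0∞}
  {J : E →L[ℝ] Lp ℝ 1 μ}

/-- A strictly singular operator sends bounded positive disjoint sequences to null sequences. -/
theorem IsLatticeEmbeddingAbove.exists_norm_map_disjoint_lt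
    (hDH : IsDisjointlyHomogeneous 2 E) (hE : IsOrderContinuousNorm E) (hq : 1 ≤ q) (hq' : q ≠ ∞)
    (hJ : IsLatticeEmbeddingAbove q J) {T : E →L[ℝ] E} (hT : IsStrictlySingular T)
    (h : ℕ → E) (h0 : ∀ n, 0 ≤ h n) (h1 : ∀ n, ‖h n‖ ≤ 1) (hd : ∀ m n, m ≠ n → h m ⊓ h n = 0)
    (ε : ℝ) (hε : 0 < ε) : ∃ N, ∀ n ≥ N, ‖T (h n)‖ < ε := by
  by_contra! hcon
  obtain ⟨θ, hθ, hθε⟩ := extraction_of_frequently_atTop (P := fun n => ε ≤ ‖T (h n)‖)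
    (frequently_atTop.mpr hcon)
  have hpos : ∀ k, 0 < ‖h (θ k)‖ := fun k => by
    rw [norm_pos_iff]
    intro hk
    have := hθε k
    rw [hk, map_zero, norm_zero] at this
    linarith
  set z : ℕ → E := fun k => ‖h (θ k)‖⁻¹ • h (θ k) with hz
  have hz0 : ∀ k, 0 ≤ z k := fun k => smul_nonneg (by positivity) (h0 _)
  have hzn : IsNormalizedDisjoint z := by
    refine ⟨fun k => ?_, fun m n hmn => ?_⟩
    · rw [hz, norm_smul, norm_inv, norm_norm, inv_mul_cancel₀ (hpos k).ne']
    · rw [abs_of_nonneg (hz0 m), abs_of_nonneg (hz0 n)]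
      have h2 := smul_inf_eq_zero (c := ‖h (θ m)‖⁻¹) (by positivity) (h0 _) (h0 _)
        (hd (θ m) (θ n) (hθ.injective.ne hmn))
      rw [inf_comm] at h2
      have h3 := smul_inf_eq_zero (c := ‖h (θ n)‖⁻¹) (by positivity) (h0 _) (hz0 m) h2
      rwa [inf_comm] at h3
  obtain ⟨ψ, -, heq⟩ := hDH z hzn
  refine hJ.not_isStrictlySingular hDH hE hq hq' T heq.exists_two_estimates.1 hε (fun k => ?_) hT
  rw [Function.comp, hz, map_smul, norm_smul, norm_inv, norm_norm]
  calc ε ≤ ‖T (h (θ (ψ k)))‖ := hθε _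
    _ ≤ ‖h (θ (ψ k))‖⁻¹ * ‖T (h (θ (ψ k)))‖ :=
      le_mul_of_one_le_left (norm_nonneg _) ((one_le_inv₀ (hpos _)).mpr (h1 _))

/-- A strictly singular operator is compact on the order interval of elements that are bounded as
functions. -/
theorem IsLatticeEmbeddingAbove.totallyBounded_image_order_interval
    (hDH : IsDisjointlyHomogeneous 2 E) (hE : IsOrderContinuousNorm E) (hq : 1 ≤ q) (hq' : q ≠ ∞)
    (hJ : IsLatticeEmbeddingAbove q J) {T : E →L[ℝ] E} (hT : IsStrictlySingular T)
    {e : E} (he : J e =ᵐ[μ] fun _ => (1 : ℝ)) (M : ℕ) :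
    TotallyBounded (T '' {z : E | |z| ≤ (M : ℝ) • e}) := by
  by_contra hcon
  obtain ⟨ε, hε, u, huM, hu⟩ := exists_seq_of_not_totallyBounded T hcon
  have huB : ∀ n, ∀ᵐ ω ∂μ, |J (u n) ω| ≤ M := fun n => by
    filter_upwards [hJ.ae_le_of_le (huM n), hJ.coeFn_abs (u n), coeFn_smul J M e, he]
      with ω h1 h2 h3 h4
    rwa [h2, h3, h4, mul_one] at h1
  -- Differences are used because their integrals against any fixed bounded function can be made
  -- small, while their images stay separated from `0`.
  set V : ℕ × ℕ → E := fun i => u i.2 - u i.1 with hV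
  -- The extra `1` ensures that the bound is at least `1` even for `M = 0`.
  have hVB : ∀ i, ∀ᵐ ω ∂μ, |J (V i) ω| ≤ 2 * M + 1 := fun i => by
    filter_upwards [huB i.2, huB i.1, coeFn_sub J (u i.2) (u i.1)] with ω h1 h2 h3
    rw [h3]
    linarith [abs_sub (J (u i.2) ω) (J (u i.1) ω)]
  have hm : ∀ x, AEStronglyMeasurable (J x) μ := fun x => Lp.aestronglyMeasurable _
  set U : Ultrafilter ℕ := hyperfilter ℕ with hU
  have hUle : (U : Filter ℕ) ≤ atTop := Nat.hyperfilter_le_atTop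
  set F : Filter (ℕ × ℕ) := (U : Filter ℕ).curry U with hF
  let Q : ℕ → (ℕ → ℕ × ℕ) → ℕ × ℕ → Prop := fun k f i =>
    ε ≤ ‖T (V i)‖ ∧ ∀ S ∈ (Finset.range k).powerset,
      |∫ ω, J (V i) ω * ∏ l ∈ S, J (V (f l)) ω ∂μ| ≤
        (1 / 4 : ℝ) ^ (k + 1) * ∏ l ∈ S, (1 / 4 : ℝ) ^ (l + 1)
  obtain ⟨f, hf⟩ := exists_seq_of_forall_step Q (by
    intro k f g i hfg hi
    have hprod : ∀ S ∈ (Finset.range k).powerset, ∀ ω,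
        ∏ l ∈ S, J (V (f l)) ω = ∏ l ∈ S, J (V (g l)) ω := fun S hS ω =>
      Finset.prod_congr rfl fun l hl => by
        rw [hfg l (Finset.mem_range.mp (Finset.mem_powerset.mp hS hl))]
    refine ⟨hi.1, fun S hS => ?_⟩
    have h := hi.2 S hS
    simpa only [hprod S hS] using h) (by
    intro k f _
    suffices h : ∀ᶠ i in F, Q k f i by
      obtain ⟨m, hm⟩ := (eventually_curry_iff.mp h).exists
      obtain ⟨n, hn⟩ := hm.exists
      exact ⟨(m, n), hn⟩
    refine Filter.Eventually.and ?_ ?_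
    · refine eventually_curry_iff.mpr (Eventually.of_forall fun m => ?_)
      filter_upwards [hUle (eventually_gt_atTop m)] with n hn
      rw [hV, map_sub]
      exact hu m n hn
    · rw [eventually_all_finset]
      intro S _
      set g : Ω → ℝ := fun ω => ∏ l ∈ S, J (V (f l)) ω with hg
      have hgm : AEStronglyMeasurable g μ :=
        aestronglyMeasurable_finset_prod (fun l => hm (V (f l))) S
      have hgB := ae_abs_prod_le (fun l => hVB (f l)) S
      have hbd : ∀ n, ∀ᵐ ω ∂μ, ‖J (u n) ω * g ω‖ ≤ M * (2 * M + 1) ^ S.card := fun n => by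
        filter_upwards [huB n, hgB] with ω h1 h2
        rw [norm_mul]
        exact mul_le_mul h1 h2 (abs_nonneg _) (Nat.cast_nonneg M)
      have hint : ∀ n, Integrable (fun ω => J (u n) ω * g ω) μ := fun n =>
        Integrable.of_bound ((hm _).mul hgm) _ (hbd n)
      obtain ⟨L, hL⟩ := U.exists_tendsto_of_abs_le (b := fun n => ∫ ω, J (u n) ω * g ω ∂μ)
        (K := M * (2 * M + 1) ^ S.card) fun n => by
          have := norm_integral_le_of_norm_le_const (hbd n)
          simpa using this
      have hpos : 0 < (1 / 4 : ℝ) ^ (k + 1) * ∏ l ∈ S, (1 / 4 : ℝ) ^ (l + 1) := by positivity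
      filter_upwards [eventually_curry_abs_sub_lt hL hpos] with i hi
      have h1 : ∫ ω, J (V i) ω * g ω ∂μ =
          ∫ ω, J (u i.2) ω * g ω ∂μ - ∫ ω, J (u i.1) ω * g ω ∂μ := by
        rw [← integral_sub (hint _) (hint _)]
        refine integral_congr_ae ?_
        filter_upwards [coeFn_sub J (u i.2) (u i.1)] with ω h
        rw [h, sub_mul]
      rw [h1]
      exact hi.le)
  have hupper : HasUpperTwoEstimate fun k => V (f k) := by
    refine hJ.hasUpperTwoEstimate hq hq' _ (B := 2 * M + 1)
      (by have := (Nat.cast_nonneg M : (0 : ℝ) ≤ M); linarith) (fun k => hVB (f k)) fun S => ?_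
    -- The weight for `S` was secured when its largest index was chosen.
    rcases S.eq_empty_or_nonempty with rfl | hne
    · simp
    have hmem := S.max'_mem hne
    have hsub : S.erase (S.max' hne) ∈ (Finset.range (S.max' hne)).powerset := by
      refine Finset.mem_powerset.mpr fun l hl => Finset.mem_range.mpr ?_
      exact lt_of_le_of_ne (S.le_max' l (Finset.mem_of_mem_erase hl)) (Finset.ne_of_mem_erase hl)
    have h := (hf (S.max' hne)).2 _ hsub
    have e1 := Finset.mul_prod_erase S (fun l => (1 / 4 : ℝ) ^ (l + 1)) hmem
    have e2 := fun ω => Finset.mul_prod_erase S (fun l => J (V (f l)) ω) hmem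
    simpa only [e1, e2] using h
  exact hJ.not_isStrictlySingular hDH hE hq hq' T hupper hε (fun k => (hf k).1) hT

/-- Up to `ε / 2`, the image of the unit ball lies in the totally bounded image of an order interval
`|z| ≤ M • e`. -/
theorem IsLatticeEmbeddingAbove.isCompactOperator
    (hDH : IsDisjointlyHomogeneous 2 E) (hE : IsOrderContinuousNorm E) (hq : 1 ≤ q) (hq' : q ≠ ∞)
    (hJ : IsLatticeEmbeddingAbove q J) {T : E →L[ℝ] E} (hT : IsStrictlySingular T) :
    IsCompactOperator T := by
  have htb : TotallyBounded (T '' Metric.closedBall 0 1) := by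
    obtain ⟨e, he0, he⟩ := hJ.exists_coeFn_eq_one
    rw [Metric.totallyBounded_iff]
    intro ε hε
    obtain ⟨u, hu0, hu⟩ := exists_forall_norm_map_posPart_sub_le T
      (hJ.exists_norm_map_disjoint_lt hDH hE hq hq' hT) (by positivity : 0 < ε / 8)
    obtain ⟨M, hM⟩ := hJ.exists_norm_posPart_sub_smul_lt hE he0 he u
      (by positivity : 0 < ε / (8 * (‖T‖ + 1)))
    obtain ⟨t, htfin, ht⟩ := Metric.totallyBounded_iff.mp
      (hJ.totallyBounded_image_order_interval hDH hE hq hq' hT he M) (ε / 2) (by positivity)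
    have hMe : 0 ≤ (M : ℝ) • e := smul_nonneg (Nat.cast_nonneg M) he0
    have hpos : ∀ x : E, 0 ≤ x → ‖x‖ ≤ 1 →
        ‖T x - T (x ⊓ u ⊓ (M : ℝ) • e)‖ < ε / 4 := by
      intro x hx hx1
      -- The error splits into the excess over `u`, small under `T`, and the excess of `x ⊓ u` over
      -- `M • e`, small in norm.
      have h1 : x - x ⊓ u ⊓ (M : ℝ) • e = (x - u)⁺ + (x ⊓ u - (M : ℝ) • e)⁺ := by
        rw [inf_eq_sub_posPart_sub (x ⊓ u) ((M : ℝ) • e), ← sub_add, inf_eq_sub_posPart_sub x u,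
          sub_sub_cancel]
      have h2 : ‖(x ⊓ u - (M : ℝ) • e)⁺‖ ≤ ‖(u - (M : ℝ) • e)⁺‖ :=
        norm_le_norm_of_nonneg_of_le (posPart_nonneg _)
          (posPart_mono (sub_le_sub_right inf_le_right _))
      rw [← map_sub, h1, map_add]
      have h3 : ‖T (x ⊓ u - (M : ℝ) • e)⁺‖ < ε / 8 := by
        calc ‖T (x ⊓ u - (M : ℝ) • e)⁺‖ ≤ ‖T‖ * ‖(u - (M : ℝ) • e)⁺‖ :=
              (T.le_opNorm _).trans (mul_le_mul_of_nonneg_left h2 (norm_nonneg _))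
          _ ≤ (‖T‖ + 1) * ‖(u - (M : ℝ) • e)⁺‖ := by gcongr; linarith
          _ < (‖T‖ + 1) * (ε / (8 * (‖T‖ + 1))) :=
              mul_lt_mul_of_pos_left hM (by positivity)
          _ = ε / 8 := by field_simp
      have := norm_add_le (T (x - u)⁺) (T (x ⊓ u - (M : ℝ) • e)⁺)
      have h4 := hu x hx hx1
      linarith
    refine ⟨t, htfin, ?_⟩
    rintro _ ⟨x, hx, rfl⟩
    have hx1 : ‖x‖ ≤ 1 := by simpa using hx
    set a := x⁺ ⊓ u ⊓ (M : ℝ) • e with ha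
    set b := x⁻ ⊓ u ⊓ (M : ℝ) • e with hb
    have ha0 : 0 ≤ a := le_inf (le_inf (posPart_nonneg _) hu0) hMe
    have hb0 : 0 ≤ b := le_inf (le_inf (negPart_nonneg _) hu0) hMe
    have hab : |a - b| ≤ (M : ℝ) • e := abs_le'.mpr
      ⟨(sub_le_self _ hb0).trans inf_le_right, by
        rw [neg_sub]; exact (sub_le_self _ ha0).trans inf_le_right⟩
    have h1 := ht ⟨a - b, hab, rfl⟩
    rw [Set.mem_iUnion₂] at h1 ⊢
    obtain ⟨y, hy, hyt⟩ := h1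
    refine ⟨y, hy, ?_⟩
    rw [Metric.mem_ball] at hyt ⊢
    have h2 := hpos x⁺ (posPart_nonneg _) ((norm_posPart_le x).trans hx1)
    have h3 := hpos x⁻ (negPart_nonneg _) ((norm_negPart_le x).trans hx1)
    have h4 : dist (T x) (T (a - b)) < ε / 2 := by
      have h5 : T x - T (a - b) = (T x⁺ - T a) - (T x⁻ - T b) := by
        conv_lhs => rw [← posPart_sub_negPart x]
        simp only [map_sub]
        abel
      rw [dist_eq_norm, h5]
      refine (norm_sub_le _ _).trans_lt ?_
      linarith
    linarith [dist_triangle (T x) (T (a - b)) y]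
  refine (isCompactOperator_iff_isCompact_closure_image_closedBall (T : E →ₗ[ℝ] E)
    one_pos).mpr ?_
  exact isCompact_iff_totallyBounded_isComplete.mpr ⟨htb.closure, isClosed_closure.isComplete⟩

end Compactness

theorem mainTheorem4 (E : Type u) [NormedAddCommGroup E] [Lattice E] [IsOrderedAddMonoid E]
    [HasSolidNorm E] [NormedSpace ℝ E] [IsOrderedModule ℝ E] [CompleteSpace E]
    (hDH : IsDisjointlyHomogeneous 2 E) (hC : HasPropertyC.{u, v} E) :
    strictlySingularOperators E = compactOperators E := by
  obtain ⟨hE, q, Ω, _, μ, J, hq, hq', _, hinj, hsup, hinf, hex⟩ := hC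
  have hJ : IsLatticeEmbeddingAbove q J := ⟨hinj, hsup, hinf, hex⟩
  ext T
  exact ⟨fun hT => hJ.isCompactOperator hDH hE hq hq' hT, fun hT => hT.isStrictlySingular⟩
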